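/- Let $\mathbf V$ be a dagger compact category: a dagger symmetric monoidal category in which every object $A$ has a dual $A^*$ with unit $\eta_A\colon I\to A^*\otimes A$ and counit $\varepsilon_A=\eta_A^\dagger\circ\sigma_{A,A^*}\colon A\otimes A^*\to I$ satisfying the snake equations. Suppose $\mathbf V$ has dagger biproducts: it has a zero object, and any two objects $A,B$ have a biproduct $(A\oplus B,i_A,i_B,p_A,p_B)$ with $p_A=i_A^\dagger$ and $p_B=i_B^\dagger$. A normalisable dagger Frobenius algebra $(A,m_A,u_A,n_A)$ in $\mathbf V$ is a monoid $(A,m_A,u_A)$ with $(m_A\otimes 1)(1\otimes m_A^\dagger)=(1\otimes m_A)(m_A^\dagger\otimes 1)$, together with an isomorphism $n_A\colon A\to A$ that is positive (of the form $h^\dagger\circ h$) and central ($m_A(n_A\otimes 1)=n_A m_A=m_A(1\otimes n_A)$) and satisfies $\eta_A^\dagger\circ(1_{A^*}\otimes n_A n_A m_A)\circ(\eta_A\otimes 1_A)=u_A^\dagger$. Its action is $a_A=(1_{A^*}\otimes m_A)(\eta_A\otimes 1_A)\colon A\to A^*\otimes A$, its coaction is $a_A^\dagger$, and its involution is $s_A=a_A^\dagger\circ(1_{A^*}\otimes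 u_A)\colon A^*\to A$. The objects of $\mathrm{CP}^*[\mathbf V]$ are these algebras. Its morphisms $A\to B$ are the morphisms $f\colon A\to B$ of $\mathbf V$ for which $a_B\circ f\circ a_A^\dagger$ is completely positive, that is, equal to $(1_{B^*}\otimes\eta_X^\dagger\otimes 1_B)\circ(g_*\otimes g)$ for some object $X$ and some $g\colon A\to X\otimes B$, where $g_*=(g^\dagger)^*\colon A^*\to (X\otimes B)^*\cong B^*\otimes X^*$. Composition, identities and daggers are those of $\mathbf V$. A $*$-homomorphism $A\to B$ is a morphism $f$ of $\mathbf V$ with $f\circ m_A=m_B\circ(f\otimes f)$ and $s_B\circ f_*=f\circ s_A$. Then $\mathrm{CP}^*[\mathbf V]$ is also dagger compact and has dagger biproducts. More precisely: 1. $\mathrm{CP}^*[\mathbf V]$ is a dagger compact category whose structure is inherited from $\mathbf V$: the forgetful functor $\mathrm{CP}^*[\mathbf V]\to\mathbf V$ is strong symmetric monoidal with unitary structure maps, and under these maps the multiplication of $A\otimes B$ is $(m_A\otimes m_B)\circ(1\otimes\sigma\otimes 1)$ and its normaliser is $n_A\otimes n_B$. 2. $\mathrm{CP}^*[\mathbf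 V]$ has a zero object and a dagger biproduct of any two objects. 3. A zero object of $\mathbf V$ carries exactly one structure of normalisable dagger Frobenius algebra, and with it is a zero object of $\mathrm{CP}^*[\mathbf V]$. 4. For objects $A,B$ of $\mathrm{CP}^*[\mathbf V]$ and any dagger biproduct $(A\oplus B,i_A,i_B)$ of their underlying objects in $\mathbf V$, the block-diagonal maps $$m_{A\oplus B}=\begin{pmatrix} m_A\circ(p_A\otimes p_A)\\ m_B\circ(p_B\otimes p_B)\end{pmatrix},\qquad u_{A\oplus B}=\begin{pmatrix}u_A\\u_B\end{pmatrix},\qquad n_{A\oplus B}=n_A\oplus n_B$$ make $A\oplus B$ a normalisable dagger Frobenius algebra, the maps $i_A,i_B,p_A,p_B$ are $*$-homomorphisms, and $i_A,i_B$ are morphisms of $\mathrm{CP}^*[\mathbf V]$ that exhibit this algebra as the dagger biproduct of $A$ and $B$ in $\mathrm{CP}^*[\mathbf V]$. -/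

import Mathlib

open CategoryTheory MonoidalCategory

set_option linter.unusedSectionVars false

universe v u

namespace CPStarConstruction

noncomputable section

/-- A dagger on a category: an involutive, identity-on-objects contravariant functor. -/
class DaggerCategory (C : Type u) [Category.{v} C] where
  dagger : ∀ {X Y : C}, (X ⟶ Y) → (Y ⟶ X)
  dagger_id : ∀ X : C, dagger (𝟙 X) = 𝟙 X
  dagger_comp : ∀ {X Y Z : C} (f : X ⟶ Y) (g : Y ⟶ Z), dagger (f ≫ g) = dagger g ≫ dagger f
  dagger_dagger : ∀ {X Y : C} (f : X ⟶ Y), dagger (dagger f) = f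

postfix:max "†" => DaggerCategory.dagger

/-- A dagger symmetric monoidal category: the tensor product preserves daggers and the
coherence isomorphisms are unitary. -/
class DaggerMonoidalCategory (C : Type u) [Category.{v} C] [MonoidalCategory C]
    [SymmetricCategory C] [DaggerCategory C] : Prop where
  dagger_tensor : ∀ {X₁ Y₁ X₂ Y₂ : C} (f : X₁ ⟶ Y₁) (g : X₂ ⟶ Y₂),
    (f ⊗ₘ g)† = f† ⊗ₘ g†
  dagger_associator : ∀ X Y Z : C, (α_ X Y Z).hom† = (α_ X Y Z).inv
  dagger_leftUnitor : ∀ X : C, (λ_ X).hom† = (λ_ X).inv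
  dagger_rightUnitor : ∀ X : C, (ρ_ X).hom† = (ρ_ X).inv
  dagger_braiding : ∀ X Y : C, (β_ X Y).hom† = (β_ X Y).inv

/-- A dagger compact category: every object `A` has a dual `ᘁA`, with unit
`η_ : 𝟙_ ⟶ ᘁA ⊗ A` and counit `ε_ : A ⊗ ᘁA ⟶ 𝟙_` satisfying the snake equations, such that
the counit is the dagger of the unit, up to the symmetry. -/
class DaggerCompactCategory (C : Type u) [Category.{v} C] [MonoidalCategory C]
    [SymmetricCategory C] [DaggerCategory C] [DaggerMonoidalCategory C] extends
    LeftRigidCategory C where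
  counit_eq : ∀ A : C, ε_ (ᘁA) A = (β_ A (ᘁA)).hom ≫ (η_ (ᘁA) A)†

/-- A zero morphism: one that factors through a zero object. -/
def IsZeroMorphism {C : Type u} [Category.{v} C] {X Y : C} (f : X ⟶ Y) : Prop :=
  ∃ (Z : C) (a : X ⟶ Z) (b : Z ⟶ Y), Limits.IsZero Z ∧ f = a ≫ b

/-- The injections `i : A ⟶ P` and `j : B ⟶ P` exhibit `P` as a dagger biproduct of `A` and `B`:
with the projections `i†` and `j†`, it is both a product and a coproduct, and the biproduct
equations hold. -/
structure IsDaggerBiproduct {C : Type u} [Category.{v} C] [DaggerCategory C] {A B P : C}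
    (i : A ⟶ P) (j : B ⟶ P) : Prop where
  isProduct : Nonempty (Limits.IsLimit (Limits.BinaryFan.mk i† j†))
  isCoproduct : Nonempty (Limits.IsColimit (Limits.BinaryCofan.mk i j))
  inl_fst : i ≫ i† = 𝟙 A
  inr_snd : j ≫ j† = 𝟙 B
  inl_snd : IsZeroMorphism (i ≫ j†)
  inr_fst : IsZeroMorphism (j ≫ i†)

/-- A category has dagger biproducts if it has a zero object and a dagger biproduct of every pair
of objects. -/
def HasDaggerBiproducts (C : Type u) [Category.{v} C] [DaggerCategory C] : Prop :=
  (∃ Z : C, Limits.IsZero Z) ∧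
    ∀ A B : C, ∃ (P : C) (i : A ⟶ P) (j : B ⟶ P), IsDaggerBiproduct i j

section Construction

variable {V : Type u} [Category.{v} V] [MonoidalCategory V] [SymmetricCategory V]
  [DaggerCategory V] [DaggerMonoidalCategory V] [DaggerCompactCategory V]

/-- The conjugate `g_* : ᘁA ⟶ ᘁB` of `g : A ⟶ B`, the transpose of the dagger of `g`. -/
def conj {A B : V} (g : A ⟶ B) : (ᘁA : V) ⟶ (ᘁB : V) := ᘁ(g†)

/-- The cap `ᘁX ⊗ X ⟶ 𝟙_`. -/
def cap (X : V) : (ᘁX : V) ⊗ X ⟶ 𝟙_ V := (η_ (ᘁX) X)†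

/-- The completely positive map `ᘁA ⊗ A ⟶ ᘁB ⊗ B` with Kraus morphism `g : A ⟶ X ⊗ B`:
place `g_*` next to `g`, identify `ᘁ(X ⊗ B)` with `ᘁB ⊗ ᘁX`, and contract `ᘁX` with `X`. -/
def krausMap {A X B : V} (g : A ⟶ X ⊗ B) : (ᘁA : V) ⊗ A ⟶ (ᘁB : V) ⊗ B :=
  (conj g ⊗ₘ g) ≫ ((leftDualTensorIso X B).hom ▷ (X ⊗ B)) ≫
    (α_ _ _ _).hom ≫ (ᘁB : V) ◁ ((α_ _ _ _).inv ≫ cap X ▷ B ≫ (λ_ B).hom)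

/-- Complete positivity of a morphism `ᘁA ⊗ A ⟶ ᘁB ⊗ B`. -/
def IsCompletelyPositive {A B : V} (f : (ᘁA : V) ⊗ A ⟶ (ᘁB : V) ⊗ B) : Prop :=
  ∃ (X : V) (g : A ⟶ X ⊗ B), f = krausMap g

/-- A positive endomorphism: one of the form `h† ∘ h`. -/
def IsPositiveMorphism {A : V} (z : A ⟶ A) : Prop :=
  ∃ (B : V) (h : A ⟶ B), z = h ≫ h†

/-- A normalisable dagger Frobenius algebra structure on `A`: a monoid whose multiplication
satisfies the Frobenius law with respect to its dagger, together with a normaliser, which is a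
central positive isomorphism `n` such that the partial trace of `n ∘ n ∘ mul` is the counit `one†`. -/
structure NormalisableFrobenius (A : V) extends MonObj A where
  frobenius : A ◁ mul† ≫ (α_ A A A).inv ≫ mul ▷ A = mul† ▷ A ≫ (α_ A A A).hom ≫ A ◁ mul
  normaliser : A ⟶ A
  isIso_normaliser : IsIso normaliser
  positive_normaliser : IsPositiveMorphism normaliser
  central_left : normaliser ▷ A ≫ mul = mul ≫ normaliser
  central_right : A ◁ normaliser ≫ mul = mul ≫ normaliser
  normalisable : (λ_ A).inv ≫ η_ (ᘁA) A ▷ A ≫ (α_ _ _ _).hom ≫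
    (ᘁA : V) ◁ (mul ≫ normaliser ≫ normaliser) ≫ cap A = one†

/-- The action map `A ⟶ ᘁA ⊗ A`, the multiplication with its first input bent upwards. -/
def NormalisableFrobenius.action {A : V} (M : NormalisableFrobenius A) : A ⟶ (ᘁA : V) ⊗ A :=
  (λ_ A).inv ≫ η_ (ᘁA) A ▷ A ≫ (α_ _ _ _).hom ≫ (ᘁA : V) ◁ M.mul

/-- The coaction map `ᘁA ⊗ A ⟶ A`, the comultiplication `mul†` with its first output bent
downwards. -/
def NormalisableFrobenius.coaction {A : V} (M : NormalisableFrobenius A) :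
    (ᘁA : V) ⊗ A ⟶ A :=
  (ᘁA : V) ◁ M.mul† ≫ (α_ _ _ _).inv ≫ cap A ▷ A ≫ (λ_ A).hom


/-- The involution `ᘁA ⟶ A` of a dagger Frobenius algebra. -/
def NormalisableFrobenius.involution {A : V} (M : NormalisableFrobenius A) : (ᘁA : V) ⟶ A :=
  (ρ_ _).inv ≫ (ᘁA : V) ◁ M.one ≫ M.coaction

/-- A *-homomorphism: a morphism that preserves multiplication and involution. -/
def IsStarHomomorphism {A B : V} (M : NormalisableFrobenius A) (N : NormalisableFrobenius B)
    (f : A ⟶ B) : Prop :=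
  M.mul ≫ f = (f ⊗ₘ f) ≫ N.mul ∧ conj f ≫ N.involution = M.involution ≫ f

/- The facts below show that the morphisms of the CP*-construction are closed under composition,
identities and daggers, so that they form a dagger category. -/

lemma dagger_whiskerLeft (X : V) {Y Z : V} (f : Y ⟶ Z) : (X ◁ f)† = X ◁ f† := by
  rw [← id_tensorHom, DaggerMonoidalCategory.dagger_tensor, DaggerCategory.dagger_id,
    id_tensorHom]

lemma dagger_whiskerRight {Y Z : V} (f : Y ⟶ Z) (X : V) : (f ▷ X)† = f† ▷ X := by
  rw [← tensorHom_id, DaggerMonoidalCategory.dagger_tensor, DaggerCategory.dagger_id,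
    tensorHom_id]

lemma cap_eq (X : V) : cap X = (β_ (ᘁX : V) X).hom ≫ ε_ (ᘁX) X := by
  rw [DaggerCompactCategory.counit_eq, SymmetricCategory.symmetry_assoc, cap]

lemma dagger_hom_inv {X Y : V} (i : X ≅ Y) (h : i.hom† = i.inv) : i.inv† = i.hom := by
  rw [← h, DaggerCategory.dagger_dagger]

lemma dagger_braiding_hom (X Y : V) : (β_ X Y).hom† = (β_ Y X).hom := by
  rw [DaggerMonoidalCategory.dagger_braiding]
  exact (SymmetricCategory.braiding_swap_eq_inv_braiding X Y).symm

/-- The uncurried form of `krausMap g`, as a morphism with no duals. -/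
def krausForm {A X B : V} (g : A ⟶ X ⊗ B) : B ⊗ A ⟶ A ⊗ B :=
  B ◁ g ≫ (α_ _ _ _).inv ≫ (β_ B X).hom ▷ B ≫ g† ▷ B

/-- Bending wires, as a bijection. -/
def bendForm {A B : V} (N : B ⊗ A ⟶ A ⊗ B) : B ⊗ ((ᘁA : V) ⊗ A) ⟶ B :=
  (α_ _ _ _).inv ≫ (β_ B (ᘁA : V)).hom ▷ A ≫ (α_ _ _ _).hom ≫ (ᘁA : V) ◁ N ≫
    (α_ _ _ _).inv ≫ cap A ▷ B ≫ (λ_ B).hom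

lemma bendForm_injective {A B : V} {N N' : B ⊗ A ⟶ A ⊗ B} (h : bendForm N = bendForm N') :
    N = N' := by
  unfold bendForm at h
  rw [cancel_epi, cancel_epi, cancel_epi, cap_eq] at h
  let _ := BraidedCategory.exactPairing_swap (ᘁA : V) A
  apply (tensorLeftHomEquiv (B ⊗ A) A (ᘁA : V) B).symm.injective
  exact h

lemma dualTensor_counit (X B : V) :
    (X ⊗ B) ◁ (leftDualTensorIso X B).hom ≫ ε_ ((ᘁB : V) ⊗ (ᘁX : V)) (X ⊗ B) =
      ε_ (ᘁ(X ⊗ B) : V) (X ⊗ B) := by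
  have := @leftAdjointMate_comp_evaluation V _ _ (X ⊗ B) (X ⊗ B) ⟨(ᘁB : V) ⊗ (ᘁX : V)⟩
    ⟨(ᘁ(X ⊗ B) : V)⟩ (𝟙 _)
  rw [id_whiskerRight, Category.id_comp] at this
  exact this

/-- Uncurrying. -/
def uncurry {Z B : V} (F : Z ⟶ (ᘁB : V) ⊗ B) : B ⊗ Z ⟶ B :=
  (tensorLeftHomEquiv Z (ᘁB : V) B B).symm F

lemma uncurry_comp {Z Z' B : V} (u : Z' ⟶ Z) (F : Z ⟶ (ᘁB : V) ⊗ B) :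
    uncurry (u ≫ F) = B ◁ u ≫ uncurry F :=
  tensorLeftHomEquiv_symm_naturality _ _

lemma uncurry_contract (X B : V) :
    uncurry ((α_ (ᘁB : V) (ᘁX : V) (X ⊗ B)).hom ≫
        (ᘁB : V) ◁ ((α_ _ _ _).inv ≫ cap X ▷ B ≫ (λ_ B).hom)) =
      𝟙 _ ⊗≫ (β_ (B ⊗ ((ᘁB : V) ⊗ (ᘁX : V))) X).hom ▷ B ⊗≫
        ε_ ((ᘁB : V) ⊗ (ᘁX : V)) (X ⊗ B) ▷ B ⊗≫ 𝟙 _ := by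
  have key : (β_ (B ⊗ ((ᘁB : V) ⊗ (ᘁX : V))) X).hom ⊗≫ ε_ ((ᘁB : V) ⊗ (ᘁX : V)) (X ⊗ B) =
      𝟙 _ ⊗≫ ε_ (ᘁB : V) B ▷ ((ᘁX : V) ⊗ X) ⊗≫ cap X := by
    rw [ExactPairing.tensor_evaluation, cap_eq]
    have := BraidedCategory.braiding_naturality_left
      ((α_ _ _ _).inv ≫ ε_ (ᘁB : V) B ▷ (ᘁX : V) ≫ (λ_ _).hom) X
    calc _ = ((β_ (B ⊗ ((ᘁB : V) ⊗ (ᘁX : V))) X).hom ≫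
          X ◁ ((α_ _ _ _).inv ≫ ε_ (ᘁB : V) B ▷ (ᘁX : V) ≫ (λ_ _).hom)) ≫ ε_ (ᘁX : V) X := by
            monoidal
      _ = _ := by rw [← this]; monoidal
  calc _ = 𝟙 _ ⊗≫ ((𝟙 ((B ⊗ ((ᘁB : V) ⊗ (ᘁX : V))) ⊗ X) ⊗≫
          ε_ (ᘁB : V) B ▷ ((ᘁX : V) ⊗ X) ⊗≫ cap X) ▷ B) ⊗≫ 𝟙 B := by
        simp only [uncurry, tensorLeftHomEquiv, Equiv.coe_fn_symm_mk]
        have h4 := whisker_exchange (ε_ (ᘁB : V) B) (cap X ▷ B)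
        calc _ = 𝟙 _ ⊗≫ ((B ⊗ (ᘁB : V)) ◁ (cap X ▷ B) ≫ ε_ (ᘁB : V) B ▷ (𝟙_ V ⊗ B)) ⊗≫ 𝟙 B := by
              monoidal
          _ = _ := by rw [h4]; monoidal
    _ = _ := by rw [← key]; monoidal

lemma uncurry_krausMap {A X B : V} (g : A ⟶ X ⊗ B) :
    uncurry (krausMap g) =
      𝟙 _ ⊗≫ (B ⊗ (ᘁA : V)) ◁ g ⊗≫ (β_ (B ⊗ (ᘁA : V)) X).hom ▷ B ⊗≫
        (g† ▷ (ᘁA : V) ≫ ε_ (ᘁA : V) A) ▷ B ⊗≫ 𝟙 _ := by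
  have h1 := leftAdjointMate_comp_evaluation (g†)
  rw [← dualTensor_counit] at h1
  unfold krausMap
  rw [uncurry_comp, uncurry_comp, uncurry_contract]
  have h2 := BraidedCategory.braiding_naturality_left
    (B ◁ (conj g ≫ (leftDualTensorIso X B).hom)) X
  calc _ = 𝟙 _ ⊗≫ (B ⊗ (ᘁA : V)) ◁ g ⊗≫
        ((B ◁ (conj g ≫ (leftDualTensorIso X B).hom)) ▷ X ≫ (β_ _ X).hom) ▷ B ⊗≫
          ε_ ((ᘁB : V) ⊗ (ᘁX : V)) (X ⊗ B) ▷ B ⊗≫ 𝟙 _ := by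
        rw [tensorHom_def']; monoidal
    _ = 𝟙 _ ⊗≫ (B ⊗ (ᘁA : V)) ◁ g ⊗≫ (β_ (B ⊗ (ᘁA : V)) X).hom ▷ B ⊗≫
        ((X ⊗ B) ◁ conj g ≫ (X ⊗ B) ◁ (leftDualTensorIso X B).hom ≫
          ε_ ((ᘁB : V) ⊗ (ᘁX : V)) (X ⊗ B)) ▷ B ⊗≫ 𝟙 _ := by
        rw [h2]; monoidal
    _ = _ := by rw [← h1]; rfl

lemma uncurry_krausMap' {A X B : V} (g : A ⟶ X ⊗ B) :
    uncurry (krausMap g) = bendForm (krausForm g) := by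
  rw [uncurry_krausMap]
  unfold bendForm krausForm
  rw [cap_eq]
  have h1 := BraidedCategory.braiding_naturality_right (ᘁA : V) (g†)
  have h2 := BraidedCategory.yang_baxter B (ᘁA : V) X
  have h3 : (β_ (ᘁA : V) B).hom ≫ (β_ B (ᘁA : V)).hom = 𝟙 _ := SymmetricCategory.symmetry _ _
  symm
  calc _ = 𝟙 _ ⊗≫ (B ⊗ (ᘁA : V)) ◁ g ⊗≫ (β_ B (ᘁA : V)).hom ▷ X ▷ B ⊗≫
        (ᘁA : V) ◁ (β_ B X).hom ▷ B ⊗≫ ((ᘁA : V) ◁ g† ≫ (β_ _ _).hom ≫ ε_ (ᘁA : V) A) ▷ B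
          ⊗≫ 𝟙 _ := by
        have h4 := whisker_exchange (β_ B (ᘁA : V)).hom g
        calc _ = 𝟙 _ ⊗≫ ((β_ B (ᘁA : V)).hom ▷ A ≫ ((ᘁA : V) ⊗ B) ◁ g) ⊗≫
                (ᘁA : V) ◁ (β_ B X).hom ▷ B ⊗≫
                ((ᘁA : V) ◁ g† ≫ (β_ _ _).hom ≫ ε_ (ᘁA : V) A) ▷ B ⊗≫ 𝟙 _ := by monoidal
          _ = _ := by rw [← h4]; monoidal
    _ = 𝟙 _ ⊗≫ (B ⊗ (ᘁA : V)) ◁ g ⊗≫ ((α_ _ _ _).inv ≫ (β_ B (ᘁA : V)).hom ▷ X ≫ (α_ _ _ _).hom ≫ 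
        (ᘁA : V) ◁ (β_ B X).hom ≫ (α_ _ _ _).inv ≫ (β_ (ᘁA : V) X).hom ▷ B ≫ (α_ _ _ _).hom) ▷ B ⊗≫
          (X ◁ (β_ (ᘁA : V) B).hom) ▷ B ⊗≫ (g† ▷ (ᘁA : V) ≫ ε_ (ᘁA : V) A) ▷ B
          ⊗≫ 𝟙 _ := by 
        rw [reassoc_of% h1, BraidedCategory.braiding_tensor_right_hom]; monoidal
    _ = 𝟙 _ ⊗≫ (B ⊗ (ᘁA : V)) ◁ g ⊗≫ (B ◁ (β_ (ᘁA : V) X).hom ⊗≫ (β_ B X).hom ▷ (ᘁA : V) ⊗≫ 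
          (X ◁ ((β_ B (ᘁA : V)).hom ≫ (β_ (ᘁA : V) B).hom))) ▷ B ⊗≫ (g† ▷ (ᘁA : V) ≫ ε_ (ᘁA : V) A) ▷ B
          ⊗≫ 𝟙 _ := by 
        rw [h2]; monoidal
    _ = _ := by rw [SymmetricCategory.symmetry, BraidedCategory.braiding_tensor_left_hom]; monoidal

/-- The uncurried form of `action ∘ f ∘ coaction`. -/
def frobForm {A B : V} (M : NormalisableFrobenius A) (N : NormalisableFrobenius B) (f : A ⟶ B) :
    B ⊗ A ⟶ A ⊗ B :=
  B ◁ M.mul† ≫ (α_ _ _ _).inv ≫ (β_ B A).hom ▷ A ≫ (α_ _ _ _).hom ≫ A ◁ (B ◁ f ≫ N.mul)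

lemma uncurry_frob {A B : V} (M : NormalisableFrobenius A) (N : NormalisableFrobenius B)
    (f : A ⟶ B) : uncurry (M.coaction ≫ f ≫ N.action) = bendForm (frobForm M N f) := by
  have h0 : uncurry N.action = N.mul :=
    (tensorLeftHomEquiv B (ᘁB : V) B B).symm_apply_apply N.mul
  have h1 := BraidedCategory.braiding_naturality_right B (cap A)
  have h2 := BraidedCategory.braiding_tensor_right_hom B (ᘁA : V) A
  rw [uncurry_comp, uncurry_comp, h0]
  unfold bendForm frobForm NormalisableFrobenius.coaction
  symm
  calc _ = 𝟙 _ ⊗≫ B ◁ (ᘁA : V) ◁ M.mul† ⊗≫ ((α_ _ _ _).inv ≫ (β_ B (ᘁA : V)).hom ▷ A ≫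
          (α_ _ _ _).hom ≫ (ᘁA : V) ◁ (β_ B A).hom ≫ (α_ _ _ _).inv) ▷ A ⊗≫
          (((ᘁA : V) ⊗ A) ◁ (B ◁ f ≫ N.mul) ≫ cap A ▷ B) ⊗≫ 𝟙 _ := by
        have h4 := whisker_exchange (β_ B (ᘁA : V)).hom M.mul†
        calc _ = 𝟙 _ ⊗≫ ((β_ B (ᘁA : V)).hom ▷ A ≫ ((ᘁA : V) ⊗ B) ◁ M.mul†) ⊗≫
                ((ᘁA : V) ◁ (β_ B A).hom) ▷ A ⊗≫
                (((ᘁA : V) ⊗ A) ◁ (B ◁ f ≫ N.mul) ≫ cap A ▷ B) ⊗≫ 𝟙 _ := by monoidal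
          _ = _ := by rw [← h4]; monoidal
    _ = 𝟙 _ ⊗≫ B ◁ (ᘁA : V) ◁ M.mul† ⊗≫ ((β_ B ((ᘁA : V) ⊗ A)).hom ≫ cap A ▷ B) ▷ A ⊗≫
          (B ◁ f ≫ N.mul) ⊗≫ 𝟙 _ := by 
        rw [← h2, whisker_exchange]; monoidal
    _ = _ := by rw [← h1, braiding_tensorUnit_right]; monoidal

lemma frob_eq_kraus_iff {A B X : V} (M : NormalisableFrobenius A) (N : NormalisableFrobenius B)
    (f : A ⟶ B) (g : A ⟶ X ⊗ B) :
    M.coaction ≫ f ≫ N.action = krausMap g ↔ frobForm M N f = krausForm g := by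
  rw [← (tensorLeftHomEquiv ((ᘁA : V) ⊗ A) (ᘁB : V) B B).symm.apply_eq_iff_eq]
  change uncurry _ = uncurry _ ↔ _
  rw [uncurry_frob, uncurry_krausMap']
  exact ⟨bendForm_injective, fun h => by rw [h]⟩

namespace NormalisableFrobenius

variable {A : V} (M : NormalisableFrobenius A)

/-- The cup `mul† ∘ one`. -/
def cup : 𝟙_ V ⟶ A ⊗ A := M.one ≫ M.mul†

lemma one_mul' : M.one ▷ A ≫ M.mul = (λ_ A).hom := M.one_mul

lemma mul_one' : A ◁ M.one ≫ M.mul = (ρ_ A).hom := M.mul_one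

lemma mul_assoc' : M.mul ▷ A ≫ M.mul = (α_ A A A).hom ≫ A ◁ M.mul ≫ M.mul := M.mul_assoc

lemma counit_left : M.mul† ≫ M.one† ▷ A = (λ_ A).inv := by
  rw [← dagger_whiskerRight, ← DaggerCategory.dagger_comp, one_mul',
    DaggerMonoidalCategory.dagger_leftUnitor]

lemma counit_right : M.mul† ≫ A ◁ M.one† = (ρ_ A).inv := by
  rw [← dagger_whiskerLeft, ← DaggerCategory.dagger_comp, mul_one',
    DaggerMonoidalCategory.dagger_rightUnitor]

lemma comul_eq_left : M.mul† = (λ_ A).inv ≫ M.cup ▷ A ≫ (α_ A A A).hom ≫ A ◁ M.mul := by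
  have h := whisker_exchange M.one M.mul†
  calc M.mul† = (λ_ A).inv ≫ (𝟙_ V ◁ M.mul† ≫ M.one ▷ (A ⊗ A)) ≫ (α_ _ _ _).inv ≫ M.mul ▷ A := by
        calc _ = M.mul† ⊗≫ (M.one ▷ A ≫ M.mul) ▷ A := by rw [one_mul']; monoidal
          _ = _ := by monoidal
    _ = (λ_ A).inv ≫ M.one ▷ A ≫ (A ◁ M.mul† ≫ (α_ _ _ _).inv ≫ M.mul ▷ A) := by
        rw [h]; monoidal
    _ = _ := by rw [M.frobenius, cup]; monoidal

lemma comul_eq_right : M.mul† = (ρ_ A).inv ≫ A ◁ M.cup ≫ (α_ A A A).inv ≫ M.mul ▷ A := by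
  have h := whisker_exchange M.mul† M.one
  calc M.mul† = (ρ_ A).inv ≫ (M.mul† ▷ 𝟙_ V ≫ (A ⊗ A) ◁ M.one) ≫ (α_ _ _ _).hom ≫ A ◁ M.mul := by
        calc _ = M.mul† ⊗≫ A ◁ (A ◁ M.one ≫ M.mul) := by rw [mul_one']; monoidal
          _ = _ := by monoidal
    _ = (ρ_ A).inv ≫ A ◁ M.one ≫ (M.mul† ▷ A ≫ (α_ _ _ _).hom ≫ A ◁ M.mul) := by
        rw [← h]; monoidal
    _ = _ := by rw [← M.frobenius, cup]; monoidal

/-- The square of the normaliser. -/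
def sq : A ⟶ A := M.normaliser ≫ M.normaliser

lemma sq_left : M.sq ▷ A ≫ M.mul = M.mul ≫ M.sq := by
  simp only [sq, comp_whiskerRight, Category.assoc]
  rw [M.central_left, reassoc_of% M.central_left]

lemma sq_right : A ◁ M.sq ≫ M.mul = M.mul ≫ M.sq := by
  simp only [sq, MonoidalCategory.whiskerLeft_comp, Category.assoc]
  rw [M.central_right, reassoc_of% M.central_right]

lemma dagger_normaliser : M.normaliser† = M.normaliser := by
  obtain ⟨B, h, hh⟩ := M.positive_normaliser
  rw [hh, DaggerCategory.dagger_comp, DaggerCategory.dagger_dagger]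

/-- Auxiliary morphism. -/
def psi : A ⟶ (ᘁA : V) := tensorLeftHomEquiv A (ᘁA : V) A (𝟙_ V) (M.mul ≫ M.one†) ≫ (ρ_ _).hom

lemma psi_counit : A ◁ M.psi ≫ ε_ (ᘁA : V) A = M.mul ≫ M.one† := by
  have h := (tensorLeftHomEquiv A (ᘁA : V) A (𝟙_ V)).symm_apply_apply (M.mul ≫ M.one†)
  rw [← h, psi]
  simp only [tensorLeftHomEquiv, Equiv.coe_fn_symm_mk, Equiv.coe_fn_mk]
  monoidal

lemma cup_psi : M.cup ≫ M.psi ▷ A = η_ (ᘁA : V) A := by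
  apply (tensorLeftHomEquiv _ (ᘁA : V) A A).symm.injective
  simp only [tensorLeftHomEquiv, Equiv.coe_fn_symm_mk]
  rw [ExactPairing.coevaluation_evaluation_assoc]
  calc _ = 𝟙 _ ⊗≫ A ◁ M.cup ⊗≫ (A ◁ M.psi ≫ ε_ (ᘁA : V) A) ▷ A ⊗≫ 𝟙 _ := by monoidal
    _ = 𝟙 _ ⊗≫ ((ρ_ A).inv ≫ A ◁ M.cup ≫ (α_ A A A).inv ≫ M.mul ▷ A) ≫ M.one† ▷ A ⊗≫ 𝟙 _ := by
        rw [psi_counit]; monoidal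
    _ = 𝟙 _ ⊗≫ (M.mul† ≫ M.one† ▷ A) ⊗≫ 𝟙 _ := by rw [← comul_eq_right]; monoidal
    _ = _ := by rw [counit_left]; monoidal

/-- The trace over `ᘁA` computed with the Frobenius structure. -/
lemma trace_eq {X : V} (T : A ⊗ X ⟶ A) :
    (λ_ X).inv ≫ η_ (ᘁA : V) A ▷ X ≫ (α_ _ _ _).hom ≫ (ᘁA : V) ◁ T ≫ cap A =
      (λ_ X).inv ≫ M.cup ▷ X ≫ (α_ _ _ _).hom ≫ A ◁ T ≫ (β_ A A).hom ≫ M.mul ≫ M.one† := by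
  rw [← M.psi_counit, ← M.cup_psi, cap_eq, ← BraidedCategory.braiding_naturality_left_assoc]
  have h := whisker_exchange M.psi T
  calc _ = (λ_ X).inv ≫ M.cup ▷ X ≫ (α_ _ _ _).hom ≫ (M.psi ▷ (A ⊗ X) ≫ (ᘁA : V) ◁ T) ≫
        (β_ (ᘁA : V) A).hom ≫ ε_ (ᘁA : V) A := by monoidal
    _ = _ := by rw [← h]; simp only [Category.assoc]

lemma trace_normal : (λ_ A).inv ≫ M.cup ▷ A ≫ (α_ _ _ _).hom ≫ A ◁ (M.mul ≫ M.sq) ≫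
    (β_ A A).hom ≫ M.mul ≫ M.one† = M.one† := by
  rw [← M.trace_eq]; exact M.normalisable

lemma sym_left : M.mul ≫ M.one† = M.mul† ▷ A ≫ (α_ _ _ _).hom ≫ A ◁ (M.mul ≫ M.sq) ≫
    (β_ A A).hom ≫ M.mul ≫ M.one† := by
  conv_lhs => rw [← trace_normal]
  rw [comul_eq_left]
  have h := whisker_exchange M.cup M.mul
  calc _ = (λ_ (A ⊗ A)).inv ≫ (𝟙_ V ◁ M.mul ≫ M.cup ▷ A) ≫ (α_ _ _ _).hom ≫
        A ◁ (M.mul ≫ M.sq) ≫ (β_ A A).hom ≫ M.mul ≫ M.one† := by monoidal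
    _ = (λ_ (A ⊗ A)).inv ≫ M.cup ▷ (A ⊗ A) ⊗≫ A ◁ ((α_ A A A).hom ≫ A ◁ M.mul ≫ M.mul) ≫
        A ◁ M.sq ≫ (β_ A A).hom ≫ M.mul ≫ M.one† := by rw [h]; monoidal
    _ = _ := by rw [← mul_assoc']; monoidal

lemma sym_right : (β_ A A).hom ≫ M.mul ≫ M.one† =
    M.mul† ▷ A ≫ (α_ _ _ _).hom ≫ A ◁ (M.mul ≫ M.sq) ≫
    (β_ A A).hom ≫ M.mul ≫ M.one† := by
  obtain ⟨q, hq⟩ : ∃ q : A ⟶ A ⊗ A, q = (λ_ A).inv ≫ M.cup ▷ A ≫ (α_ _ _ _).hom ≫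
    A ◁ (M.mul ≫ M.sq) := ⟨_, rfl⟩
  have hR : M.mul† ▷ A ≫ (α_ _ _ _).hom ≫ A ◁ (M.mul ≫ M.sq) ≫ (β_ A A).hom ≫ M.mul ≫ M.one† =
      A ◁ (q ≫ (β_ A A).hom) ≫ (α_ _ _ _).inv ≫ (β_ A A).hom ▷ A ≫ (α_ _ _ _).hom ≫
        A ◁ M.mul ≫ M.mul ≫ M.one† := by
    have h := whisker_exchange M.mul (M.mul ≫ M.sq)
    have h2 := BraidedCategory.braiding_naturality_left M.mul A
    rw [comul_eq_right]
    calc _ = 𝟙 _ ⊗≫ A ◁ M.cup ▷ A ⊗≫ (M.mul ▷ (A ⊗ A) ≫ A ◁ (M.mul ≫ M.sq)) ≫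
          (β_ A A).hom ≫ M.mul ≫ M.one† := by monoidal
      _ = A ◁ q ⊗≫ (M.mul ▷ A ≫ (β_ A A).hom) ≫ M.mul ≫ M.one† := by
          rw [← h, hq]; monoidal
      _ = _ := by rw [h2, BraidedCategory.braiding_tensor_left_hom]; monoidal
  have hL : M.mul ≫ M.one† = q ▷ A ≫ (α_ _ _ _).hom ≫ A ◁ M.mul ≫ (β_ A A).hom ≫
      M.mul ≫ M.one† := by
    have hd : q = M.mul† ≫ A ◁ M.sq := by rw [hq, comul_eq_left]; monoidal
    have h5 := M.sym_left
    rw [← M.sq_left] at h5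
    refine h5.trans ?_
    rw [hd]
    monoidal
  rw [hR]
  conv_lhs => rw [hL]
  have h1 := BraidedCategory.braiding_naturality_right A q
  have h2 := BraidedCategory.braiding_naturality_right A M.mul
  have h3 := BraidedCategory.yang_baxter A A A
  calc _ = A ◁ q ≫ (β_ A (A ⊗ A)).hom ≫ (α_ _ _ _).hom ≫ (A ◁ M.mul ≫ (β_ A A).hom) ≫
        M.mul ≫ M.one† := by rw [reassoc_of% h1]; simp only [Category.assoc]
    _ = A ◁ q ≫ ((α_ _ _ _).inv ≫ (β_ A A).hom ▷ A ≫ (α_ _ _ _).hom ≫ A ◁ (β_ A A).hom ≫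
          (α_ _ _ _).inv ≫ (β_ A A).hom ▷ A ≫ (α_ _ _ _).hom) ≫ A ◁ (β_ A A).hom ≫
          (α_ _ _ _).inv ≫ (M.mul ▷ A ≫ M.mul) ≫ M.one† := by
        rw [h2, BraidedCategory.braiding_tensor_right_hom]; monoidal
    _ = A ◁ q ≫ A ◁ (β_ A A).hom ≫ (α_ _ _ _).inv ≫ (β_ A A).hom ▷ A ≫ (α_ _ _ _).hom ≫
          A ◁ ((β_ A A).hom ≫ (β_ A A).hom) ≫
          (α_ _ _ _).inv ≫ (M.mul ▷ A ≫ M.mul) ≫ M.one† := by rw [h3]; monoidal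
    _ = _ := by rw [SymmetricCategory.symmetry, mul_assoc']; monoidal

lemma form_symm : (β_ A A).hom ≫ M.mul ≫ M.one† = M.mul ≫ M.one† := by
  rw [sym_right, ← sym_left]

lemma cup_symm : M.cup ≫ (β_ A A).hom = M.cup := by
  have h := congrArg (fun f => f†) M.form_symm
  simp only [DaggerCategory.dagger_comp, DaggerCategory.dagger_dagger, dagger_braiding_hom,
    Category.assoc] at h
  simpa only [cup, Category.assoc] using h

lemma cup_mul_sq : M.cup ≫ M.mul ≫ M.sq = M.one := by
  have h := M.trace_normal
  rw [form_symm] at h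
  obtain ⟨w, hw⟩ : ∃ w, w = M.cup ≫ M.mul ≫ M.sq := ⟨_, rfl⟩
  have h1 : (λ_ A).inv ≫ w ▷ A ≫ M.mul ≫ M.one† = M.one† := by
    conv_rhs => rw [← h]
    rw [hw]
    calc _ = (λ_ A).inv ≫ M.cup ▷ A ≫ M.mul ▷ A ≫ (M.sq ▷ A ≫ M.mul) ≫ M.one† := by monoidal
      _ = (λ_ A).inv ≫ M.cup ▷ A ≫ (M.mul ▷ A ≫ M.mul) ≫ M.sq ≫ M.one† := by
          rw [sq_left]; simp only [Category.assoc]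
      _ = (λ_ A).inv ≫ M.cup ▷ A ≫ (α_ _ _ _).hom ≫ A ◁ M.mul ≫ (A ◁ M.sq ≫ M.mul) ≫ M.one† := by
          rw [mul_assoc', sq_right]; simp only [Category.assoc]
      _ = _ := by monoidal
  rw [← hw]
  have h2 := whisker_exchange w M.cup
  calc w = w ≫ (M.mul† ≫ M.one† ▷ A) ≫ (λ_ A).hom := by rw [counit_left]; simp
    _ = 𝟙 _ ⊗≫ (w ▷ 𝟙_ V ≫ A ◁ M.cup) ⊗≫ (M.mul ≫ M.one†) ▷ A ⊗≫ 𝟙 _ := by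
        rw [comul_eq_right]; monoidal
    _ = M.cup ⊗≫ ((λ_ A).inv ≫ w ▷ A ≫ M.mul ≫ M.one†) ▷ A ⊗≫ 𝟙 _ := by
        rw [← h2]; monoidal
    _ = M.one ≫ (M.mul† ≫ M.one† ▷ A) ⊗≫ 𝟙 _ := by rw [h1, cup]; monoidal
    _ = _ := by rw [counit_left]; monoidal

end NormalisableFrobenius

section Closure

variable {A B C : V} (M : NormalisableFrobenius A) (N : NormalisableFrobenius B)
  (P : NormalisableFrobenius C)

lemma swap_one_left : A ◁ M.cup ≫ (α_ _ _ _).inv ≫ (β_ A A).hom ▷ A ≫ (α_ _ _ _).hom ≫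
    A ◁ M.mul = (ρ_ A).hom ≫ M.mul† ≫ (β_ A A).hom := by
  have h := BraidedCategory.braiding_naturality_left M.mul A
  have h3 : A ◁ (β_ A A).hom ≫ A ◁ (β_ A A).hom = 𝟙 _ := by
    rw [← MonoidalCategory.whiskerLeft_comp, SymmetricCategory.symmetry,
      MonoidalCategory.whiskerLeft_id]
  have h4 : A ◁ M.cup = A ◁ M.cup ≫ A ◁ (β_ A A).hom := by
    rw [← MonoidalCategory.whiskerLeft_comp, M.cup_symm]
  conv_lhs => rw [h4]
  symm
  calc _ = A ◁ M.cup ≫ (α_ _ _ _).inv ≫ (M.mul ▷ A ≫ (β_ A A).hom) := by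
        rw [M.comul_eq_right]; simp
    _ = _ := by
        rw [h, BraidedCategory.braiding_tensor_left_hom]; simp

lemma swap_one_right : A ◁ M.cup ≫ (α_ _ _ _).inv ≫ (β_ A A).hom ▷ A ≫ M.mul ▷ A =
    (ρ_ A).hom ≫ M.mul† ≫ (β_ A A).hom := by
  have h := BraidedCategory.braiding_naturality_right A M.mul
  have h2 := BraidedCategory.braiding_naturality_right A M.cup
  have h4 : A ◁ M.cup = A ◁ M.cup ≫ A ◁ (β_ A A).hom := by
    rw [← MonoidalCategory.whiskerLeft_comp, M.cup_symm]
  have h5 : M.cup ▷ A = (λ_ A).hom ≫ (ρ_ A).inv ≫ A ◁ M.cup ≫ (β_ A (A ⊗ A)).hom := by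
    rw [h2, braiding_tensorUnit_right]; simp
  have h3 := BraidedCategory.yang_baxter A A A
  symm
  calc _ = (ρ_ A).hom ≫ (λ_ A).inv ≫ M.cup ▷ A ≫ (α_ _ _ _).hom ≫ (A ◁ M.mul ≫ (β_ A A).hom) := by
        conv_lhs => rw [M.comul_eq_left]
        simp only [Category.assoc]
    _ = A ◁ M.cup ≫ ((α_ _ _ _).inv ≫ (β_ A A).hom ▷ A ≫ (α_ _ _ _).hom ≫ A ◁ (β_ A A).hom ≫
          (α_ _ _ _).inv ≫ (β_ A A).hom ▷ A ≫ (α_ _ _ _).hom) ≫ A ◁ (β_ A A).hom ≫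
          (α_ _ _ _).inv ≫ M.mul ▷ A := by
        rw [h, h5, BraidedCategory.braiding_tensor_right_hom]; simp
    _ = (A ◁ M.cup ≫ A ◁ (β_ A A).hom) ≫ (α_ _ _ _).inv ≫ (β_ A A).hom ▷ A ≫ (α_ _ _ _).hom ≫
          A ◁ ((β_ A A).hom ≫ (β_ A A).hom) ≫
          (α_ _ _ _).inv ≫ M.mul ▷ A := by rw [h3]; monoidal
    _ = _ := by rw [SymmetricCategory.symmetry, ← h4]; simp

lemma frobForm_id : frobForm M M (𝟙 A) = krausForm M.mul† := by
  unfold frobForm krausForm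
  rw [DaggerCategory.dagger_dagger]
  have h1 := whisker_exchange (β_ A A).hom M.mul
  have h2 := whisker_exchange M.mul M.mul
  calc _ = 𝟙 _ ⊗≫ A ◁ M.cup ▷ A ⊗≫ ((A ⊗ A) ◁ M.mul ≫ (β_ A A).hom ▷ A) ⊗≫ A ◁ M.mul := by
        rw [M.comul_eq_left]; monoidal
    _ = 𝟙 _ ⊗≫ A ◁ M.cup ▷ A ⊗≫ (β_ A A).hom ▷ A ▷ A ⊗≫
          A ◁ ((α_ _ _ _).hom ≫ A ◁ M.mul ≫ M.mul) := by
        rw [h1]; monoidal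
    _ = 𝟙 _ ⊗≫ (A ◁ M.cup ≫ (α_ _ _ _).inv ≫ (β_ A A).hom ▷ A ≫ (α_ _ _ _).hom ≫
          A ◁ M.mul) ▷ A ⊗≫ A ◁ M.mul := by rw [← M.mul_assoc']; monoidal
    _ = 𝟙 _ ⊗≫ (A ◁ M.cup ≫ (α_ _ _ _).inv ≫ (β_ A A).hom ▷ A ≫ M.mul ▷ A) ▷ A ⊗≫
          A ◁ M.mul := by rw [swap_one_left, swap_one_right]
    _ = 𝟙 _ ⊗≫ A ◁ M.cup ▷ A ⊗≫ (β_ A A).hom ▷ A ▷ A ⊗≫ (M.mul ▷ (A ⊗ A) ≫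
          A ◁ M.mul) := by monoidal
    _ = 𝟙 _ ⊗≫ A ◁ M.cup ▷ A ⊗≫ ((β_ A A).hom ▷ (A ⊗ A) ≫ (A ⊗ A) ◁ M.mul) ⊗≫
          M.mul ▷ A := by rw [← h2]; monoidal
    _ = _ := by rw [← h1, M.comul_eq_left]; monoidal

/-- Auxiliary: feed the cup into a form. -/
def theta (F : B ⊗ A ⟶ A ⊗ B) : A ⟶ A ⊗ B :=
  (λ_ A).inv ≫ (N.cup ≫ (β_ B B).hom) ▷ A ≫ (α_ _ _ _).hom ≫ B ◁ F ≫ (α_ _ _ _).inv ≫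
    (β_ B A).hom ▷ B ≫ (α_ _ _ _).hom ≫ A ◁ N.mul

lemma theta_frob (f : A ⟶ B) : theta N (frobForm M N f) ≫ A ◁ N.sq = M.mul† ≫ A ◁ f := by
  unfold theta frobForm
  rw [N.cup_symm]
  have h1 := whisker_exchange (β_ B A).hom (B ◁ f ≫ N.mul)
  have h2 := BraidedCategory.braiding_naturality_left N.cup A
  rw [BraidedCategory.braiding_tensor_left_hom, braiding_tensorUnit_left] at h2
  have h3 : (λ_ B).inv ≫ N.cup ▷ B ≫ (α_ _ _ _).hom ≫ B ◁ N.mul ≫ N.mul ≫ N.sq = 𝟙 B := by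
    calc _ = (λ_ B).inv ≫ N.cup ▷ B ≫ (N.mul ▷ B ≫ N.mul) ≫ N.sq := by
          rw [N.mul_assoc']; simp only [Category.assoc]
      _ = (λ_ B).inv ≫ N.cup ▷ B ≫ N.mul ▷ B ≫ (N.sq ▷ B ≫ N.mul) := by
          rw [N.sq_left]; simp only [Category.assoc]
      _ = (λ_ B).inv ≫ (N.cup ≫ N.mul ≫ N.sq) ▷ B ≫ N.mul := by monoidal
      _ = _ := by rw [N.cup_mul_sq, N.one_mul']; simp
  have h4 := whisker_exchange N.cup M.mul†
  have h5 := whisker_exchange M.mul† f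
  calc _ = (λ_ A).inv ≫ (N.cup ▷ A ≫ (B ⊗ B) ◁ M.mul†) ⊗≫ B ◁ (β_ B A).hom ▷ A ⊗≫
        ((B ⊗ A) ◁ (B ◁ f ≫ N.mul) ≫ (β_ B A).hom ▷ B) ⊗≫ A ◁ (N.mul ≫ N.sq) := by monoidal
    _ = M.mul† ⊗≫ (N.cup ▷ A ≫ (α_ _ _ _).hom ≫ B ◁ (β_ B A).hom ≫ (α_ _ _ _).inv ≫
          (β_ B A).hom ▷ B ≫ (α_ _ _ _).hom) ▷ A ⊗≫
          A ◁ (B ◁ (B ◁ f ≫ N.mul) ≫ N.mul ≫ N.sq) := by rw [← h4, h1]; monoidal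
    _ = M.mul† ⊗≫ A ◁ (N.cup ▷ A ≫ (B ⊗ B) ◁ f) ⊗≫ A ◁ (B ◁ N.mul ≫ N.mul ≫ N.sq) := by
        rw [h2]; monoidal
    _ = M.mul† ⊗≫ A ◁ (f ≫ (λ_ B).inv ≫ N.cup ▷ B ≫ (α_ _ _ _).hom ≫ B ◁ N.mul ≫
          N.mul ≫ N.sq) := by rw [← whisker_exchange]; monoidal
    _ = _ := by rw [h3]; monoidal

lemma theta_kraus {X : V} (g : A ⟶ X ⊗ B) : theta N (krausForm g) =
    g ≫ X ◁ N.mul† ≫ (α_ _ _ _).inv ≫ g† ▷ B := by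
  unfold theta krausForm
  have h1 := BraidedCategory.braiding_naturality_right B (g†)
  rw [BraidedCategory.braiding_tensor_right_hom] at h1
  have h2 := BraidedCategory.braiding_naturality_left (N.cup ≫ (β_ B B).hom) X
  rw [BraidedCategory.braiding_tensor_left_hom, braiding_tensorUnit_left] at h2
  have h3 := whisker_exchange (N.cup ≫ (β_ B B).hom) g
  have h4 := whisker_exchange (g†) N.mul
  calc _ = (λ_ A).inv ≫ ((N.cup ≫ (β_ B B).hom) ▷ A ≫ (B ⊗ B) ◁ g) ⊗≫
        B ◁ (β_ B X).hom ▷ B ⊗≫ (B ◁ g† ≫ (β_ B A).hom) ▷ B ⊗≫ A ◁ N.mul := by monoidal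
    _ = g ⊗≫ ((N.cup ≫ (β_ B B).hom) ▷ X ≫ (α_ _ _ _).hom ≫ B ◁ (β_ B X).hom ≫
          (α_ _ _ _).inv ≫ (β_ B X).hom ▷ B ≫ (α_ _ _ _).hom) ▷ B ⊗≫ X ◁ (β_ B B).hom ▷ B ⊗≫
          (g† ▷ (B ⊗ B) ≫ A ◁ N.mul) := by
        rw [← h3, h1]; monoidal
    _ = g ⊗≫ X ◁ (N.cup ≫ ((β_ B B).hom ≫ (β_ B B).hom)) ▷ B ⊗≫
          ((X ⊗ B) ◁ N.mul ≫ g† ▷ B) := by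
        rw [h2, h4]; monoidal
    _ = _ := by
        rw [SymmetricCategory.symmetry]
        conv_rhs => rw [N.comul_eq_left]
        monoidal

lemma frobForm_sq (h : B ⟶ C) :
    C ◁ N.normaliser ≫ frobForm N P h ≫ N.normaliser ▷ C = frobForm N P (N.sq ≫ h) := by
  unfold frobForm
  have e1 := congrArg (fun f => f†) N.central_left
  have e2 := congrArg (fun f => f†) N.central_right
  simp only [DaggerCategory.dagger_comp, dagger_whiskerLeft, dagger_whiskerRight,
    N.dagger_normaliser] at e1 e2
  have h1 := whisker_exchange N.normaliser (C ◁ h ≫ P.mul)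
  have h2 := BraidedCategory.braiding_naturality_right C N.normaliser
  calc _ = C ◁ (N.normaliser ≫ N.mul†) ⊗≫ (β_ C B).hom ▷ B ⊗≫
        (B ◁ (C ◁ h ≫ P.mul) ≫ N.normaliser ▷ C) := by monoidal
    _ = C ◁ (N.normaliser ≫ N.mul†) ⊗≫ ((β_ C B).hom ≫ N.normaliser ▷ C) ▷ B ⊗≫
        (B ◁ (C ◁ h ≫ P.mul)) := by rw [h1]; monoidal
    _ = C ◁ (N.normaliser ≫ (N.mul† ≫ N.normaliser ▷ B)) ⊗≫ (β_ C B).hom ▷ B ⊗≫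
        (B ◁ (C ◁ h ≫ P.mul)) := by rw [← h2]; monoidal
    _ = C ◁ (N.mul† ≫ B ◁ N.sq) ⊗≫ (β_ C B).hom ▷ B ⊗≫ (B ◁ (C ◁ h ≫ P.mul)) := by
        rw [e1, ← e2, reassoc_of% e2.symm, NormalisableFrobenius.sq]; monoidal
    _ = C ◁ N.mul† ⊗≫ ((C ⊗ B) ◁ N.sq ≫ (β_ C B).hom ▷ B) ⊗≫ (B ◁ (C ◁ h ≫ P.mul)) := by
        monoidal
    _ = _ := by rw [whisker_exchange]; monoidal

lemma frobForm_comp (f : A ⟶ B) (h : B ⟶ C) {X Y : V} (g : A ⟶ X ⊗ B) (k : B ⟶ Y ⊗ C)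
    (hf : frobForm M N f = krausForm g) (hh : frobForm N P h = krausForm k) :
    frobForm M P (f ≫ h) = krausForm (g ≫ X ◁ (N.normaliser ≫ k) ≫ (α_ _ _ _).inv) := by
  have hQ : (g ≫ X ◁ N.mul† ≫ (α_ _ _ _).inv ≫ g† ▷ B) ≫ A ◁ N.sq = M.mul† ≫ A ◁ f := by
    rw [← theta_kraus, ← hf, theta_frob]
  have h0 := frobForm_sq N P h
  have h1 := whisker_exchange (β_ C X).hom (N.normaliser ≫ k)
  have h2 := whisker_exchange (β_ C X).hom N.mul†
  have h3 := BraidedCategory.braiding_naturality_right C (g†)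
  rw [BraidedCategory.braiding_tensor_right_hom] at h3
  have h4 := whisker_exchange (β_ C A).hom (N.sq)
  have h5 := whisker_exchange (β_ C A).hom f
  have h6 := whisker_exchange (g†) (C ◁ (N.sq ≫ h) ≫ P.mul)
  symm
  calc _ = C ◁ g ⊗≫ ((C ⊗ X) ◁ (N.normaliser ≫ k) ≫ (β_ C X).hom ▷ (Y ⊗ C)) ⊗≫
        X ◁ ((β_ C Y).hom ▷ C ≫ k† ▷ C ≫ N.normaliser ▷ C) ⊗≫ g† ▷ C := by
        unfold krausForm
        simp only [DaggerCategory.dagger_comp, dagger_whiskerLeft, N.dagger_normaliser,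
          dagger_hom_inv _ (DaggerMonoidalCategory.dagger_associator X Y C),
          BraidedCategory.braiding_tensor_right_hom]
        monoidal
    _ = C ◁ g ⊗≫ (β_ C X).hom ▷ B ⊗≫
        X ◁ (C ◁ N.normaliser ≫ krausForm k ≫ N.normaliser ▷ C) ⊗≫ g† ▷ C := by
        rw [h1]; unfold krausForm; monoidal
    _ = C ◁ g ⊗≫ ((β_ C X).hom ▷ B ≫ (X ⊗ C) ◁ N.mul†) ⊗≫ X ◁ (β_ C B).hom ▷ B ⊗≫
        ((X ⊗ B) ◁ (C ◁ (N.sq ≫ h) ≫ P.mul) ≫ g† ▷ C) := by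
        rw [← hh, h0]; unfold frobForm; monoidal
    _ = C ◁ (g ≫ X ◁ N.mul† ≫ (α_ _ _ _).inv) ⊗≫ ((α_ _ _ _).inv ≫ (β_ C X).hom ▷ B ≫
          (α_ _ _ _).hom ≫ X ◁ (β_ C B).hom ≫ (α_ _ _ _).inv ≫ g† ▷ C) ▷ B ⊗≫
          A ◁ (C ◁ (N.sq ≫ h) ≫ P.mul) := by
        rw [← h2, h6]; monoidal
    _ = C ◁ (g ≫ X ◁ N.mul† ≫ (α_ _ _ _).inv ≫ g† ▷ B) ⊗≫ ((β_ C A).hom ▷ B ≫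
          (A ⊗ C) ◁ N.sq) ⊗≫ A ◁ (C ◁ h ≫ P.mul) := by
        have h3' : ((α_ _ _ _).inv ≫ (β_ C X).hom ▷ B ≫
          (α_ _ _ _).hom ≫ X ◁ (β_ C B).hom ≫ (α_ _ _ _).inv ≫ g† ▷ C) =
            C ◁ g† ≫ (β_ C A).hom := by rw [h3]; simp
        rw [h3']; monoidal
    _ = C ◁ ((g ≫ X ◁ N.mul† ≫ (α_ _ _ _).inv ≫ g† ▷ B) ≫ A ◁ N.sq) ⊗≫ (β_ C A).hom ▷ B ⊗≫
          A ◁ (C ◁ h ≫ P.mul) := by rw [← h4]; monoidal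
    _ = C ◁ M.mul† ⊗≫ ((C ⊗ A) ◁ f ≫ (β_ C A).hom ▷ B) ⊗≫ A ◁ (C ◁ h ≫ P.mul) := by
        rw [hQ]; monoidal
    _ = _ := by rw [h5]; unfold frobForm; monoidal

lemma frobForm_dagger (f : A ⟶ B) : frobForm N M (f†) = (frobForm M N f)† := by
  unfold frobForm
  simp only [DaggerCategory.dagger_comp, dagger_whiskerLeft, dagger_whiskerRight,
    dagger_hom_inv _ (DaggerMonoidalCategory.dagger_associator _ _ _), dagger_braiding_hom,
    DaggerMonoidalCategory.dagger_associator, DaggerCategory.dagger_dagger]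
  have h := whisker_exchange (β_ A B).hom (f†)
  calc _ = A ◁ N.mul† ⊗≫ ((β_ A B).hom ▷ B ≫ (B ⊗ A) ◁ f†) ⊗≫ B ◁ M.mul := by monoidal
    _ = _ := by rw [← h]; monoidal

lemma snake_swap (X B : V) : (X ⊗ B) ◁ η_ (ᘁX : V) X ≫ (α_ _ _ _).inv ≫
    (β_ (X ⊗ B) (ᘁX : V)).hom ▷ X ≫ (α_ (ᘁX : V) X B).inv ▷ X ≫ cap X ▷ B ▷ X ≫
      (λ_ B).hom ▷ X = (ρ_ _).hom ≫ (β_ X B).hom := by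
  have h1 := BraidedCategory.braiding_naturality_right B (η_ (ᘁX : V) X)
  rw [BraidedCategory.braiding_tensor_right_hom, braiding_tensorUnit_right] at h1
  have h2 : (β_ X B).hom ≫ (β_ B X).hom = 𝟙 _ := SymmetricCategory.symmetry _ _
  have h3 : (β_ B X).hom ≫ (β_ X B).hom = 𝟙 _ := SymmetricCategory.symmetry _ _
  have h4 : (β_ X (ᘁX : V)).hom ≫ cap X = ε_ (ᘁX : V) X := by
    rw [cap_eq, SymmetricCategory.symmetry_assoc]
  have h1' : B ◁ η_ (ᘁX : V) X ⊗≫ (β_ B (ᘁX : V)).hom ▷ X =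
      𝟙 _ ⊗≫ η_ (ᘁX : V) X ▷ B ⊗≫ (ᘁX : V) ◁ (β_ X B).hom ⊗≫ 𝟙 _ := by
    calc _ = B ◁ η_ (ᘁX : V) X ⊗≫ (β_ B (ᘁX : V)).hom ▷ X ⊗≫
          (ᘁX : V) ◁ ((β_ B X).hom ≫ (β_ X B).hom) ⊗≫ 𝟙 _ := by rw [h3]; monoidal
      _ = (B ◁ η_ (ᘁX : V) X ≫ (α_ _ _ _).inv ≫ (β_ B (ᘁX : V)).hom ▷ X ≫
          (α_ _ _ _).hom ≫ (ᘁX : V) ◁ (β_ B X).hom ≫ (α_ _ _ _).inv) ⊗≫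
          (ᘁX : V) ◁ (β_ X B).hom ⊗≫ 𝟙 _ := by monoidal
      _ = _ := by rw [h1]; monoidal
  have h5 := whisker_exchange (ε_ (ᘁX : V) X) (β_ X B).hom
  rw [BraidedCategory.braiding_tensor_left_hom]
  calc _ = 𝟙 _ ⊗≫ X ◁ (B ◁ η_ (ᘁX : V) X ⊗≫ (β_ B (ᘁX : V)).hom ▷ X) ⊗≫
        ((β_ X (ᘁX : V)).hom ≫ cap X) ▷ (B ⊗ X) ⊗≫ 𝟙 _ := by monoidal
    _ = 𝟙 _ ⊗≫ X ◁ η_ (ᘁX : V) X ▷ B ⊗≫ ((X ⊗ (ᘁX : V)) ◁ (β_ X B).hom ≫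
          ε_ (ᘁX : V) X ▷ (B ⊗ X)) ⊗≫ 𝟙 _ := by rw [h4, h1']; monoidal
    _ = 𝟙 _ ⊗≫ (X ◁ η_ (ᘁX : V) X ≫ (α_ _ _ _).inv ≫ ε_ (ᘁX : V) X ▷ X) ▷ B ⊗≫
          (β_ X B).hom ⊗≫ 𝟙 _ := by rw [h5]; monoidal
    _ = _ := by rw [ExactPairing.coevaluation_evaluation]; monoidal

lemma krausForm_dagger {X : V} (g : A ⟶ X ⊗ B) : (krausForm g)† =
    krausForm ((λ_ B).inv ≫ η_ (ᘁX : V) X ▷ B ≫ (α_ _ _ _).hom ≫ (ᘁX : V) ◁ g†) := by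
  unfold krausForm
  simp only [DaggerCategory.dagger_comp, dagger_whiskerLeft, dagger_whiskerRight,
    dagger_hom_inv _ (DaggerMonoidalCategory.dagger_associator _ _ _), dagger_braiding_hom,
    DaggerMonoidalCategory.dagger_associator, DaggerCategory.dagger_dagger,
    dagger_hom_inv _ (DaggerMonoidalCategory.dagger_leftUnitor _)]
  have h0 : (η_ (ᘁX : V) X)† = cap X := rfl
  rw [h0]
  have hS := snake_swap X B
  have h1 := whisker_exchange (β_ A (ᘁX : V)).hom (g†)
  have h2 := BraidedCategory.braiding_naturality_left g (ᘁX : V)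
  have h3 := whisker_exchange g (η_ (ᘁX : V) X)
  obtain ⟨w, hw⟩ : ∃ w : (ᘁX : V) ⊗ A ⟶ B,
    w = (ᘁX : V) ◁ g ≫ (α_ (ᘁX : V) X B).inv ≫ cap X ▷ B ≫ (λ_ B).hom := ⟨_, rfl⟩
  have h4 := whisker_exchange w (g†)
  symm
  calc _ = 𝟙 _ ⊗≫ A ◁ η_ (ᘁX : V) X ▷ B ⊗≫ ((A ⊗ (ᘁX : V)) ◁ g† ≫
        (β_ A (ᘁX : V)).hom ▷ A) ⊗≫ w ▷ A := by rw [hw]; monoidal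
    _ = 𝟙 _ ⊗≫ A ◁ η_ (ᘁX : V) X ▷ B ⊗≫ (β_ A (ᘁX : V)).hom ▷ X ▷ B ⊗≫
        (((ᘁX : V) ⊗ A) ◁ g† ≫ w ▷ A) := by rw [h1]; monoidal
    _ = 𝟙 _ ⊗≫ A ◁ η_ (ᘁX : V) X ▷ B ⊗≫ ((β_ A (ᘁX : V)).hom ≫ (ᘁX : V) ◁ g) ▷ X ▷ B ⊗≫
        cap X ▷ (B ⊗ X ⊗ B) ⊗≫ B ◁ g† := by rw [h4, hw]; monoidal
    _ = 𝟙 _ ⊗≫ (A ◁ η_ (ᘁX : V) X ≫ g ▷ ((ᘁX : V) ⊗ X)) ▷ B ⊗≫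
        (β_ (X ⊗ B) (ᘁX : V)).hom ▷ X ▷ B ⊗≫
        cap X ▷ (B ⊗ X ⊗ B) ⊗≫ B ◁ g† := by rw [← h2]; monoidal
    _ = g ▷ B ⊗≫ ((X ⊗ B) ◁ η_ (ᘁX : V) X ≫ (α_ _ _ _).inv ≫
        (β_ (X ⊗ B) (ᘁX : V)).hom ▷ X ≫ (α_ (ᘁX : V) X B).inv ▷ X ≫ cap X ▷ B ▷ X ≫
        (λ_ B).hom ▷ X) ▷ B ⊗≫ B ◁ g† := by rw [h3]; monoidal
    _ = _ := by rw [hS]; monoidal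

end Closure

/-- A normalisable dagger Frobenius algebra in `V`. -/
structure CPStar (V : Type u) [Category.{v} V] [MonoidalCategory V] [SymmetricCategory V]
    [DaggerCategory V] [DaggerMonoidalCategory V] [DaggerCompactCategory V] where
  X : V
  frob : NormalisableFrobenius X

namespace CPStar

/-- A morphism `f` of `V` such that `action ∘ f ∘ coaction` is completely positive. -/
@[ext]
structure Hom (A B : CPStar V) where
  hom : A.X ⟶ B.X
  cp : IsCompletelyPositive (A.frob.coaction ≫ hom ≫ B.frob.action)

instance : Category (CPStar V) where
  Hom := Hom
  id A := ⟨𝟙 A.X, A.X, A.frob.mul†,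
    (frob_eq_kraus_iff A.frob A.frob (𝟙 A.X) A.frob.mul†).2 (frobForm_id A.frob)⟩
  comp {A B C} f h := ⟨f.hom ≫ h.hom, by
    obtain ⟨X, g, hg⟩ := f.cp
    obtain ⟨Y, k, hk⟩ := h.cp
    exact ⟨X ⊗ Y, _, (frob_eq_kraus_iff A.frob C.frob _ _).2
      (frobForm_comp A.frob B.frob C.frob f.hom h.hom g k
        ((frob_eq_kraus_iff _ _ _ _).1 hg) ((frob_eq_kraus_iff _ _ _ _).1 hk))⟩⟩
  id_comp f := Hom.ext (Category.id_comp f.hom)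
  comp_id f := Hom.ext (Category.comp_id f.hom)
  assoc f g h := Hom.ext (Category.assoc f.hom g.hom h.hom)

instance : DaggerCategory (CPStar V) where
  dagger {A B} f := ⟨f.hom†, by
    obtain ⟨X, g, hg⟩ := f.cp
    exact ⟨(ᘁX : V), _, (frob_eq_kraus_iff B.frob A.frob _ _).2 (by
      rw [frobForm_dagger, (frob_eq_kraus_iff _ _ _ _).1 hg, krausForm_dagger])⟩⟩
  dagger_id A := Hom.ext (DaggerCategory.dagger_id A.X)
  dagger_comp f g := Hom.ext (DaggerCategory.dagger_comp f.hom g.hom)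
  dagger_dagger f := Hom.ext (DaggerCategory.dagger_dagger f.hom)

variable (V) in
/-- The functor that forgets the Frobenius structure. -/
def forget : CPStar V ⥤ V where
  obj A := A.X
  map f := f.hom

end CPStar

end Construction

end

end CPStarConstruction

open CPStarConstruction

/-! A morphism of CP*[V] is determined by its underlying morphism of V, so every equation in CP*[V]
may be checked in V. What remains is to show that certain data are algebras and that certain
morphisms are completely positive, and both questions can be asked without mentioning dual objects.
For algebras, normalisability amounts to symmetry of the Frobenius form together with the equation
that multiplying the two legs of the cup and applying the squared normaliser gives the unit;
`SymmetricFrobenius.normalisable` is the direction needed to build new algebras. For morphisms,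
bending wires turns complete positivity of `f` into an equation `frobForm M N f = krausForm g`,
abbreviated `IsCP`.

Monoidal structure: both forms of a tensor product are, up to regrouping, tensor products of forms
(`frobForm_tensor`, `krausForm_tensor`), so tensor products of completely positive morphisms are
completely positive. The coherence isomorphisms are unitary and multiplicative, hence completely
positive (`isCP_of_unitary`). The dual of an algebra is its opposite on the same object, with the
Frobenius cup as unit of the duality; the cup is completely positive because multiplication by it is
a positive morphism (`op_tensor_mul_cup`).

Biproducts: every object has a dual, so tensoring has an adjoint and morphisms into or out of tensor
products of biproducts are determined by their matrix entries. Each law of the block-diagonal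
algebra then reduces to the same law for a summand on the diagonal, and to zero off it. The main
point is that the pairing of completely positive morphisms with Kraus morphisms into `X ⊗ A` and `Y
⊗ B` is completely positive (`IsDaggerBiproduct.isCP_of_components`): the ancilla `X ⊕ Y` works,
since orthogonality of `X` and `Y` kills the cross terms exactly where block-diagonal multiplication
does. The dagger converts this product into a coproduct. -/

namespace CPStarConstruction

noncomputable section

/-! ### Normalisability without dual objects. -/

section SymmetricFrobenius

variable {V : Type u} [Category.{v} V] [MonoidalCategory V] [SymmetricCategory V]
  [DaggerCategory V] [DaggerMonoidalCategory V] [DaggerCompactCategory V]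

/-- A dagger Frobenius structure with symmetric form and a normaliser, with the normalisation
condition expressed by the comultiplication instead of a dual object. -/
structure SymmetricFrobenius (A : V) extends MonObj A where
  frobenius : A ◁ mul† ≫ (α_ A A A).inv ≫ mul ▷ A = mul† ▷ A ≫ (α_ A A A).hom ≫ A ◁ mul
  normaliser : A ⟶ A
  isIso_normaliser : IsIso normaliser
  positive_normaliser : IsPositiveMorphism normaliser
  central_left : normaliser ▷ A ≫ mul = mul ≫ normaliser
  central_right : A ◁ normaliser ≫ mul = mul ≫ normaliser
  form_symm : (β_ A A).hom ≫ mul ≫ one† = mul ≫ one†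
  cup_mul_sq : one ≫ mul† ≫ mul ≫ normaliser ≫ normaliser = one

namespace SymmetricFrobenius

variable {A : V} (M : SymmetricFrobenius A)

lemma one_mul' : M.one ▷ A ≫ M.mul = (λ_ A).hom := M.one_mul

lemma mul_one' : A ◁ M.one ≫ M.mul = (ρ_ A).hom := M.mul_one

lemma mul_assoc' : M.mul ▷ A ≫ M.mul = (α_ A A A).hom ≫ A ◁ M.mul ≫ M.mul := M.mul_assoc

lemma counit_left : M.mul† ≫ M.one† ▷ A = (λ_ A).inv := by
  rw [← dagger_whiskerRight, ← DaggerCategory.dagger_comp, one_mul',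
    DaggerMonoidalCategory.dagger_leftUnitor]

lemma comul_eq_right : M.mul† = (ρ_ A).inv ≫ A ◁ (M.one ≫ M.mul†) ≫ (α_ A A A).inv ≫
    M.mul ▷ A := by
  have h := whisker_exchange M.mul† M.one
  calc M.mul† = (ρ_ A).inv ≫ (M.mul† ▷ 𝟙_ V ≫ (A ⊗ A) ◁ M.one) ≫ (α_ _ _ _).hom ≫ A ◁ M.mul := by
        calc _ = M.mul† ⊗≫ A ◁ (A ◁ M.one ≫ M.mul) := by rw [mul_one']; monoidal
          _ = _ := by monoidal
    _ = (ρ_ A).inv ≫ A ◁ M.one ≫ (M.mul† ▷ A ≫ (α_ _ _ _).hom ≫ A ◁ M.mul) := by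
        rw [← h]; monoidal
    _ = _ := by rw [← M.frobenius]; monoidal

/-- The comparison of the self-duality given by the Frobenius structure with the dual `ᘁA`. -/
def toDual : A ⟶ (ᘁA : V) := tensorLeftHomEquiv A (ᘁA : V) A (𝟙_ V) (M.mul ≫ M.one†) ≫ (ρ_ _).hom

lemma toDual_evaluation : A ◁ M.toDual ≫ ε_ (ᘁA : V) A = M.mul ≫ M.one† := by
  have h := (tensorLeftHomEquiv A (ᘁA : V) A (𝟙_ V)).symm_apply_apply (M.mul ≫ M.one†)
  rw [← h, toDual]
  simp only [tensorLeftHomEquiv, Equiv.coe_fn_symm_mk, Equiv.coe_fn_mk]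
  monoidal

/-- After transposing, the left side becomes a snake made of the Frobenius form and its cup, which
the Frobenius and unit laws straighten. Thus `toDual` carries the Frobenius self-duality to the
chosen one. -/
lemma cup_toDual : (M.one ≫ M.mul†) ≫ M.toDual ▷ A = η_ (ᘁA : V) A := by
  apply (tensorLeftHomEquiv _ (ᘁA : V) A A).symm.injective
  simp only [tensorLeftHomEquiv, Equiv.coe_fn_symm_mk]
  rw [ExactPairing.coevaluation_evaluation_assoc]
  calc _ = 𝟙 _ ⊗≫ A ◁ (M.one ≫ M.mul†) ⊗≫ (A ◁ M.toDual ≫ ε_ (ᘁA : V) A) ▷ A ⊗≫ 𝟙 _ := by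
        monoidal
    _ = 𝟙 _ ⊗≫ ((ρ_ A).inv ≫ A ◁ (M.one ≫ M.mul†) ≫ (α_ A A A).inv ≫ M.mul ▷ A) ≫
          M.one† ▷ A ⊗≫ 𝟙 _ := by rw [toDual_evaluation]; monoidal
    _ = 𝟙 _ ⊗≫ (M.mul† ≫ M.one† ▷ A) ⊗≫ 𝟙 _ := by rw [← comul_eq_right]; monoidal
    _ = _ := by rw [counit_left]; monoidal

/-- The loop through `ᘁA` is replaced by the Frobenius cup and form, sliding `toDual` round it.
Symmetry of the form removes the crossing; associativity and centrality then gather the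
multiplication and the squared normaliser on the cup, where they give the unit. -/
lemma normalisable : (λ_ A).inv ≫ η_ (ᘁA : V) A ▷ A ≫ (α_ _ _ _).hom ≫
    (ᘁA : V) ◁ (M.mul ≫ M.normaliser ≫ M.normaliser) ≫ cap A = M.one† := by
  obtain ⟨s, hs⟩ : ∃ s, s = M.normaliser ≫ M.normaliser := ⟨_, rfl⟩
  obtain ⟨c, hc⟩ : ∃ c, c = M.one ≫ M.mul† := ⟨_, rfl⟩
  have hl : s ▷ A ≫ M.mul = M.mul ≫ s := by
    rw [hs, comp_whiskerRight, Category.assoc, M.central_left, reassoc_of% M.central_left]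
  have hr : A ◁ s ≫ M.mul = M.mul ≫ s := by
    rw [hs, MonoidalCategory.whiskerLeft_comp, Category.assoc, M.central_right,
      reassoc_of% M.central_right]
  have h := whisker_exchange M.toDual (M.mul ≫ s)
  have h0 : c ≫ M.mul ≫ s = M.one := by rw [hc, hs, Category.assoc, M.cup_mul_sq]
  rw [← hs, ← M.cup_toDual, ← hc, cap_eq]
  calc _ = (λ_ A).inv ≫ c ▷ A ≫ (α_ _ _ _).hom ≫ (M.toDual ▷ (A ⊗ A) ≫
          (ᘁA : V) ◁ (M.mul ≫ s)) ≫ (β_ (ᘁA : V) A).hom ≫ ε_ (ᘁA : V) A := by monoidal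
    _ = (λ_ A).inv ≫ c ▷ A ≫ (α_ _ _ _).hom ≫ A ◁ (M.mul ≫ s) ≫
          (β_ A A).hom ≫ A ◁ M.toDual ≫ ε_ (ᘁA : V) A := by
        rw [← h, ← BraidedCategory.braiding_naturality_left_assoc]
        simp only [Category.assoc]
    _ = (λ_ A).inv ≫ c ▷ A ≫ ((α_ _ _ _).hom ≫ A ◁ M.mul ≫ M.mul) ≫ s ≫ M.one† := by
        rw [toDual_evaluation, M.form_symm, MonoidalCategory.whiskerLeft_comp]
        simp only [Category.assoc]
        rw [reassoc_of% hr]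
    _ = (λ_ A).inv ≫ (c ≫ M.mul ≫ s) ▷ A ≫ M.mul ≫ M.one† := by
        rw [← mul_assoc']
        simp only [Category.assoc, comp_whiskerRight]
        rw [reassoc_of% hl]
    _ = _ := by
        rw [h0, ← Category.assoc (M.one ▷ A), M.one_mul', Iso.inv_hom_id_assoc]

/-- The normalisable dagger Frobenius algebra of a symmetric Frobenius structure. -/
def toNormalisable : NormalisableFrobenius A where
  toMonObj := M.toMonObj
  frobenius := M.frobenius
  normaliser := M.normaliser
  isIso_normaliser := M.isIso_normaliser
  positive_normaliser := M.positive_normaliser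
  central_left := M.central_left
  central_right := M.central_right
  normalisable := M.normalisable

end SymmetricFrobenius

end SymmetricFrobenius

/-! ### Tensor products, the unit algebra and opposite algebras. -/

section AlgebraConstructions

variable {V : Type u} [Category.{v} V] [MonoidalCategory V] [SymmetricCategory V]
  [DaggerCategory V] [DaggerMonoidalCategory V] [DaggerCompactCategory V]

lemma dagger_tensorμ (A B C D : V) : (tensorμ A B C D)† = tensorδ A B C D := by
  unfold tensorμ tensorδ
  simp only [DaggerCategory.dagger_comp, dagger_whiskerLeft, dagger_whiskerRight,
    dagger_hom_inv _ (DaggerMonoidalCategory.dagger_associator _ _ _),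
    DaggerMonoidalCategory.dagger_braiding,
    DaggerMonoidalCategory.dagger_associator, Category.assoc]

lemma dagger_tensorδ (A B C D : V) : (tensorδ A B C D)† = tensorμ A B C D := by
  rw [← dagger_tensorμ, DaggerCategory.dagger_dagger]

/-- Expanding the block braiding leaves a double crossing of `A` and `D`, which cancels because the
braiding is a symmetry. -/
lemma tensorμ_braiding (A B C D : V) :
    tensorμ A B C D ≫ ((β_ A C).hom ⊗ₘ (β_ B D).hom) =
      (β_ (A ⊗ B) (C ⊗ D)).hom ≫ tensorμ C D A B := by
  simp only [tensorμ, MonoidalCategory.tensorHom_def, BraidedCategory.braiding_tensor_left_hom,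
    BraidedCategory.braiding_tensor_right_hom]
  symm
  calc _ = 𝟙 _ ⊗≫ A ◁ (β_ B C).hom ▷ D ⊗≫ (β_ A C).hom ▷ (B ⊗ D) ⊗≫ C ◁ A ◁ (β_ B D).hom ⊗≫
        C ◁ ((β_ A D).hom ≫ (β_ D A).hom) ▷ B ⊗≫ 𝟙 _ := by monoidal
    _ = _ := by rw [SymmetricCategory.symmetry]; monoidal

instance (A B C D : V) : IsIso (tensorμ A B C D) :=
  ⟨tensorδ A B C D, tensorμ_tensorδ A B C D, tensorδ_tensorμ A B C D⟩

lemma tensorδ_braiding (A B C D : V) :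
    tensorδ A B C D ≫ (β_ (A ⊗ B) (C ⊗ D)).hom =
      ((β_ A C).hom ⊗ₘ (β_ B D).hom) ≫ tensorδ C D A B := by
  rw [← cancel_epi (tensorμ A B C D), tensorμ_tensorδ_assoc, reassoc_of% tensorμ_braiding A B C D,
    tensorμ_tensorδ, Category.comp_id]

/-- The whiskering of a product of two morphisms, with the factors regrouped. -/
lemma whiskerLeft_tensor_factors (A B : V) {C D C' D' : V} (f : C ⟶ C') (g : D ⟶ D') :
    (A ⊗ B) ◁ (f ⊗ₘ g) = tensorμ A B C D ≫ (A ◁ f ⊗ₘ B ◁ g) ≫ tensorδ A B C' D' := by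
  rw [← tensorμ_natural_right_assoc, tensorμ_tensorδ, Category.comp_id]

lemma whiskerRight_tensor_factors {A B A' B' : V} (f : A ⟶ A') (g : B ⟶ B') (C D : V) :
    (f ⊗ₘ g) ▷ (C ⊗ D) = tensorμ A B C D ≫ (f ▷ C ⊗ₘ g ▷ D) ≫ tensorδ A' B' C D := by
  rw [← tensorμ_natural_left_assoc, tensorμ_tensorδ, Category.comp_id]

lemma tensorδ_natural_right (A B : V) {C D C' D' : V} (f : C ⟶ C') (g : D ⟶ D') :
    tensorδ A B C D ≫ (A ⊗ B) ◁ (f ⊗ₘ g) = (A ◁ f ⊗ₘ B ◁ g) ≫ tensorδ A B C' D' := by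
  rw [whiskerLeft_tensor_factors, tensorδ_tensorμ_assoc]

lemma tensorδ_natural_left {A B A' B' : V} (f : A ⟶ A') (g : B ⟶ B') (C D : V) :
    tensorδ A B C D ≫ (f ⊗ₘ g) ▷ (C ⊗ D) = (f ▷ C ⊗ₘ g ▷ D) ≫ tensorδ A' B' C D := by
  rw [whiskerRight_tensor_factors, tensorδ_tensorμ_assoc]

/-- This is `tensor_associativity` with the interchange isomorphisms inverted, the form needed for
comultiplications. -/
lemma tensorδ_associator_hom (A A' B B' C C' : V) :
    tensorδ (A ⊗ B) (A' ⊗ B') C C' ≫ tensorδ A A' B B' ▷ (C ⊗ C') ≫ (α_ _ _ _).hom =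
      ((α_ A B C).hom ⊗ₘ (α_ A' B' C').hom) ≫
        tensorδ A A' (B ⊗ C) (B' ⊗ C') ≫ (A ⊗ A') ◁ tensorδ B B' C C' := by
  rw [← cancel_mono ((A ⊗ A') ◁ tensorμ B B' C C' ≫ tensorμ A A' (B ⊗ C) (B' ⊗ C'))]
  simp only [Category.assoc]
  rw [← tensor_associativity, ← comp_whiskerRight_assoc, tensorδ_tensorμ, id_whiskerRight,
    Category.id_comp, tensorδ_tensorμ_assoc, ← MonoidalCategory.whiskerLeft_comp_assoc,
    tensorδ_tensorμ, MonoidalCategory.whiskerLeft_id, Category.id_comp, tensorδ_tensorμ,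
    Category.comp_id]

lemma tensorδ_associator_inv (A A' B B' C C' : V) :
    tensorδ A A' (B ⊗ C) (B' ⊗ C') ≫ (A ⊗ A') ◁ tensorδ B B' C C' ≫ (α_ _ _ _).inv =
      ((α_ A B C).inv ⊗ₘ (α_ A' B' C').inv) ≫
        tensorδ (A ⊗ B) (A' ⊗ B') C C' ≫ tensorδ A A' B B' ▷ (C ⊗ C') := by
  have h := tensorδ_associator_hom A A' B B' C C'
  rw [← cancel_mono (α_ _ _ _).hom]
  simp only [Category.assoc, h, Iso.inv_hom_id, Category.comp_id]
  simp [tensorHom_comp_tensorHom_assoc]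

/-- The square of a cyclic permutation of three factors is its inverse; Yang–Baxter reduces the four
crossings to two. -/
lemma braiding_left_braiding_left (A : V) :
    (β_ (A ⊗ A) A).hom ≫ (α_ _ _ _).inv ≫ (β_ (A ⊗ A) A).hom =
      (β_ A A).hom ▷ A ≫ (α_ _ _ _).hom ≫ A ◁ (β_ A A).hom := by
  have hβ : (β_ A A).hom ≫ (β_ A A).hom = 𝟙 _ := SymmetricCategory.symmetry _ _
  have hy := BraidedCategory.yang_baxter A A A
  rw [BraidedCategory.braiding_tensor_left_hom]
  simp only [Category.assoc, Iso.hom_inv_id_assoc]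
  rw [← reassoc_of% hy]
  simp [← comp_whiskerRight_assoc, hβ]

lemma braiding_right_braiding_right (A : V) :
    (β_ A (A ⊗ A)).hom ≫ (α_ _ _ _).hom ≫ (β_ A (A ⊗ A)).hom =
      A ◁ (β_ A A).hom ≫ (α_ _ _ _).inv ≫ (β_ A A).hom ▷ A := by
  have hβ : (β_ A A).hom ≫ (β_ A A).hom = 𝟙 _ := SymmetricCategory.symmetry _ _
  have hy := BraidedCategory.yang_baxter A A A
  rw [BraidedCategory.braiding_tensor_right_hom]
  simp only [Category.assoc, Iso.inv_hom_id_assoc]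
  rw [reassoc_of% hy]
  simp [← MonoidalCategory.whiskerLeft_comp_assoc, hβ]

variable {A B : V} (M : NormalisableFrobenius A) (N : NormalisableFrobenius B)

lemma isPositiveMorphism_tensor {f : A ⟶ A} {g : B ⟶ B} (hf : IsPositiveMorphism f)
    (hg : IsPositiveMorphism g) : IsPositiveMorphism (f ⊗ₘ g) := by
  obtain ⟨X, h, rfl⟩ := hf
  obtain ⟨Y, k, rfl⟩ := hg
  exact ⟨X ⊗ Y, h ⊗ₘ k, by
    rw [DaggerMonoidalCategory.dagger_tensor, tensorHom_comp_tensorHom]⟩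

lemma isPositiveMorphism_id (A : V) : IsPositiveMorphism (𝟙 A) :=
  ⟨A, 𝟙 A, by rw [DaggerCategory.dagger_id, Category.comp_id]⟩

namespace NormalisableFrobenius

/-- Regrouping the factors by coherence presents each side as the tensor product of the
corresponding sides of the two Frobenius laws. -/
lemma tensor_frobenius :
    (A ⊗ B) ◁ (tensorμ A B A B ≫ (M.mul ⊗ₘ N.mul))† ≫ (α_ _ _ _).inv ≫
      (tensorμ A B A B ≫ (M.mul ⊗ₘ N.mul)) ▷ (A ⊗ B) =
    (tensorμ A B A B ≫ (M.mul ⊗ₘ N.mul))† ▷ (A ⊗ B) ≫ (α_ _ _ _).hom ≫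
      (A ⊗ B) ◁ (tensorμ A B A B ≫ (M.mul ⊗ₘ N.mul)) := by
  have h1 := tensorδ_associator_inv A B A B A B
  have h2 := tensorδ_associator_hom A B A B A B
  rw [DaggerCategory.dagger_comp, dagger_tensorμ, DaggerMonoidalCategory.dagger_tensor]
  simp only [MonoidalCategory.whiskerLeft_comp, comp_whiskerRight, Category.assoc]
  rw [whiskerLeft_tensor_factors A B M.mul†, whiskerRight_tensor_factors M.mul†]
  simp only [Category.assoc]
  rw [reassoc_of% h1, reassoc_of% h2, ← comp_whiskerRight_assoc,
    ← MonoidalCategory.whiskerLeft_comp_assoc, tensorδ_tensorμ, id_whiskerRight,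
    MonoidalCategory.whiskerLeft_id, Category.id_comp, Category.id_comp, tensorδ_natural_left,
    tensorδ_natural_right]
  simp only [tensorHom_comp_tensorHom_assoc, M.frobenius, N.frobenius]

/-- The tensor product of two normalisable dagger Frobenius algebras. -/
def tensor : NormalisableFrobenius (A ⊗ B) :=
  SymmetricFrobenius.toNormalisable
    { one := (λ_ (𝟙_ V)).inv ≫ (M.one ⊗ₘ N.one)
      mul := tensorμ A B A B ≫ (M.mul ⊗ₘ N.mul)
      one_mul := @MonObj.Mon_tensor_one_mul _ _ _ _ _ _ M.toMonObj N.toMonObj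
      mul_one := @MonObj.Mon_tensor_mul_one _ _ _ _ _ _ M.toMonObj N.toMonObj
      mul_assoc := @MonObj.Mon_tensor_mul_assoc _ _ _ _ _ _ M.toMonObj N.toMonObj
      frobenius := tensor_frobenius M N
      normaliser := M.normaliser ⊗ₘ N.normaliser
      isIso_normaliser := by
        have := M.isIso_normaliser
        have := N.isIso_normaliser
        infer_instance
      positive_normaliser := isPositiveMorphism_tensor M.positive_normaliser N.positive_normaliser
      central_left := by
        rw [tensorμ_natural_left_assoc, tensorHom_comp_tensorHom, M.central_left, N.central_left,
          Category.assoc, tensorHom_comp_tensorHom]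
      central_right := by
        rw [tensorμ_natural_right_assoc, tensorHom_comp_tensorHom, M.central_right,
          N.central_right, Category.assoc, tensorHom_comp_tensorHom]
      form_symm := by
        simp only [DaggerCategory.dagger_comp, DaggerMonoidalCategory.dagger_tensor, Category.assoc,
          tensorHom_comp_tensorHom_assoc]
        rw [← reassoc_of% tensorμ_braiding A B A B, tensorHom_comp_tensorHom_assoc, M.form_symm,
          N.form_symm]
      cup_mul_sq := by
        simp only [DaggerCategory.dagger_comp, DaggerMonoidalCategory.dagger_tensor, Category.assoc,
          tensorHom_comp_tensorHom, dagger_tensorμ,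
          tensorδ_tensorμ_assoc]
        have h1 := M.cup_mul_sq
        have h2 := N.cup_mul_sq
        simp only [cup, sq, Category.assoc] at h1 h2
        rw [h1, h2] }

variable (V) in
/-- The algebra structure of the tensor unit. -/
def unit : NormalisableFrobenius (𝟙_ V) :=
  SymmetricFrobenius.toNormalisable
    { one := 𝟙 _
      mul := (λ_ (𝟙_ V)).hom
      one_mul := by simp
      mul_one := by simp [unitors_equal]
      mul_assoc := by monoidal
      frobenius := by
        rw [DaggerMonoidalCategory.dagger_leftUnitor]
        monoidal
      normaliser := 𝟙 _
      isIso_normaliser := inferInstance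
      positive_normaliser := isPositiveMorphism_id _
      central_left := by simp
      central_right := by simp
      form_symm := by simp [← unitors_equal, DaggerCategory.dagger_id]
      cup_mul_sq := by simp [DaggerMonoidalCategory.dagger_leftUnitor] }

lemma op_mul_assoc : ((β_ A A).hom ≫ M.mul) ▷ A ≫ (β_ A A).hom ≫ M.mul =
    (α_ A A A).hom ≫ A ◁ ((β_ A A).hom ≫ M.mul) ≫ (β_ A A).hom ≫ M.mul := by
  have h1 := BraidedCategory.braiding_naturality_left M.mul A
  have h2 := BraidedCategory.braiding_naturality_right A M.mul
  have h3 := BraidedCategory.yang_baxter A A A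
  simp only [MonoidalCategory.whiskerLeft_comp, comp_whiskerRight, Category.assoc]
  rw [reassoc_of% h1, reassoc_of% h2, M.mul_assoc', BraidedCategory.braiding_tensor_right_hom,
    BraidedCategory.braiding_tensor_left_hom]
  simp only [Category.assoc, Iso.inv_hom_id_assoc]
  rw [← reassoc_of% h3]
  simp

/-- The law for `M` is conjugated by braidings. Naturality moves them past `mul` and `mul†`, and the
remaining double block braidings become the single crossings that define the opposite. The two sides
of the law trade places. -/
lemma op_frobenius : A ◁ ((β_ A A).hom ≫ M.mul)† ≫ (α_ A A A).inv ≫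
      ((β_ A A).hom ≫ M.mul) ▷ A =
    ((β_ A A).hom ≫ M.mul)† ▷ A ≫ (α_ A A A).hom ≫ A ◁ ((β_ A A).hom ≫ M.mul) := by
  have h1 := BraidedCategory.braiding_naturality_left M.mul† A
  have h2 := BraidedCategory.braiding_naturality_right A M.mul
  have h3 := BraidedCategory.braiding_naturality_right A M.mul†
  have h4 := BraidedCategory.braiding_naturality_left M.mul A
  rw [DaggerCategory.dagger_comp, dagger_braiding_hom]
  have e : (β_ A A).hom ≫ (A ◁ M.mul† ≫ (α_ _ _ _).inv ≫ M.mul ▷ A) ≫ (β_ A A).hom =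
      (β_ A A).hom ≫ (M.mul† ▷ A ≫ (α_ _ _ _).hom ≫ A ◁ M.mul) ≫ (β_ A A).hom := by
    rw [M.frobenius]
  simp only [Category.assoc] at e
  rw [h2, h4, ← reassoc_of% h1, ← reassoc_of% h3] at e
  rw [reassoc_of% braiding_left_braiding_left A, reassoc_of% braiding_right_braiding_right A] at e
  simpa using e.symm

/-- The opposite of a normalisable dagger Frobenius algebra. -/
def op : NormalisableFrobenius A :=
  SymmetricFrobenius.toNormalisable
    { one := M.one
      mul := (β_ A A).hom ≫ M.mul
      one_mul := by
        rw [BraidedCategory.braiding_naturality_left_assoc, M.mul_one',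
          braiding_tensorUnit_left]
        simp
      mul_one := by
        rw [BraidedCategory.braiding_naturality_right_assoc, M.one_mul',
          braiding_tensorUnit_right]
        simp
      mul_assoc := M.op_mul_assoc
      frobenius := M.op_frobenius
      normaliser := M.normaliser
      isIso_normaliser := M.isIso_normaliser
      positive_normaliser := M.positive_normaliser
      central_left := by
        rw [BraidedCategory.braiding_naturality_left_assoc, M.central_right, Category.assoc]
      central_right := by
        rw [BraidedCategory.braiding_naturality_right_assoc, M.central_left, Category.assoc]
      form_symm := by
        rw [Category.assoc, M.form_symm, M.form_symm]
      cup_mul_sq := by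
        have h := M.cup_mul_sq
        simp only [cup, sq, Category.assoc] at h
        rw [DaggerCategory.dagger_comp, dagger_braiding_hom]
        simp only [Category.assoc, SymmetricCategory.symmetry_assoc, h] }

end NormalisableFrobenius

end AlgebraConstructions

/-! ### Complete positivity: calculus of forms, tensor products and the cup. -/

section CompletePositivity

variable {V : Type u} [Category.{v} V] [MonoidalCategory V] [SymmetricCategory V]
  [DaggerCategory V] [DaggerMonoidalCategory V] [DaggerCompactCategory V]

/-- The sesquilinear version of `krausForm`. -/
def sesqForm {A X B C : V} (g : A ⟶ X ⊗ C) (g' : A ⟶ X ⊗ B) : B ⊗ A ⟶ A ⊗ C :=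
  B ◁ g ≫ (α_ _ _ _).inv ≫ (β_ B X).hom ▷ C ≫ g'† ▷ C

/-- With projections of a biproduct for `b` and `c`, this reads off the matrix entries of a Kraus
form, including the off-diagonal ones. -/
lemma sesqForm_comp {A X B B' C C' : V} (g : A ⟶ X ⊗ C) (g' : A ⟶ X ⊗ B) (c : C ⟶ C')
    (b : B ⟶ B') :
    sesqForm (g ≫ X ◁ c) (g' ≫ X ◁ b) = b† ▷ A ≫ sesqForm g g' ≫ A ◁ c := by
  unfold sesqForm
  have h1 := BraidedCategory.braiding_naturality_left b† X
  have h2 := whisker_exchange (β_ B' X).hom c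
  have h3 := whisker_exchange b† g
  have h4 := whisker_exchange (X ◁ b†) c
  have h5 := whisker_exchange g'† c
  rw [DaggerCategory.dagger_comp, dagger_whiskerLeft]
  calc _ = B' ◁ g ⊗≫ ((B' ⊗ X) ◁ c ≫ (β_ B' X).hom ▷ C') ⊗≫ (X ◁ b†) ▷ C' ≫ g'† ▷ C' := by
        monoidal
    _ = B' ◁ g ⊗≫ (β_ B' X).hom ▷ C ⊗≫ ((X ⊗ B') ◁ c ≫ (X ◁ b†) ▷ C') ≫ g'† ▷ C' := by
        rw [h2]; monoidal
    _ = B' ◁ g ⊗≫ ((β_ B' X).hom ≫ X ◁ b†) ▷ C ≫ ((X ⊗ B) ◁ c ≫ g'† ▷ C') := by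
        rw [h4]; monoidal
    _ = (B' ◁ g ≫ b† ▷ (X ⊗ C)) ⊗≫ (β_ B X).hom ▷ C ⊗≫ g'† ▷ C ≫ A ◁ c := by
        rw [← h1, h5]; monoidal
    _ = _ := by rw [h3]; monoidal

lemma krausForm_comp {A X B B' : V} (g : A ⟶ X ⊗ B) (b : B ⟶ B') :
    krausForm (g ≫ X ◁ b) = b† ▷ A ≫ krausForm g ≫ A ◁ b :=
  sesqForm_comp g g b b

/-- The ancilla wire joins the two arguments, so a morphism on it slides from one to the other and
becomes its dagger. -/
lemma sesqForm_whiskerRight {A X Y B C : V} (g : A ⟶ X ⊗ C) (g' : A ⟶ Y ⊗ B) (x : X ⟶ Y) :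
    sesqForm (g ≫ x ▷ C) g' = sesqForm g (g' ≫ x† ▷ B) := by
  unfold sesqForm
  have h1 := BraidedCategory.braiding_naturality_right B x
  rw [DaggerCategory.dagger_comp, dagger_whiskerRight, DaggerCategory.dagger_dagger]
  calc _ = B ◁ g ⊗≫ (B ◁ x ≫ (β_ B Y).hom) ▷ C ⊗≫ g'† ▷ C := by monoidal
    _ = _ := by rw [h1]; monoidal

/-- Complete positivity, formulated without dual objects. -/
def IsCP {A B : V} (M : NormalisableFrobenius A) (N : NormalisableFrobenius B) (f : A ⟶ B) :
    Prop :=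
  ∃ (X : V) (g : A ⟶ X ⊗ B), frobForm M N f = krausForm g

lemma isCompletelyPositive_iff {A B : V} (M : NormalisableFrobenius A)
    (N : NormalisableFrobenius B) (f : A ⟶ B) :
    IsCompletelyPositive (M.coaction ≫ f ≫ N.action) ↔ IsCP M N f :=
  ⟨fun ⟨X, g, h⟩ => ⟨X, g, (frob_eq_kraus_iff M N f g).1 h⟩,
    fun ⟨X, g, h⟩ => ⟨X, g, (frob_eq_kraus_iff M N f g).2 h⟩⟩

lemma isCP_dagger {A B : V} {M : NormalisableFrobenius A} {N : NormalisableFrobenius B}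
    {f : A ⟶ B} (h : IsCP M N f) : IsCP N M f† := by
  obtain ⟨X, g, hg⟩ := h
  exact ⟨(ᘁX : V), _, by rw [frobForm_dagger, hg, krausForm_dagger]⟩

/-- If multiplication by `f'` is multiplication by `f` up to `b` and `c`, then the same holds for
the corresponding forms. -/
lemma frobForm_eq_of_mul {A B B' C C' : V} (M : NormalisableFrobenius A)
    (N : NormalisableFrobenius B) (N' : NormalisableFrobenius C) (f : A ⟶ B) (f' : A ⟶ C)
    (b : C' ⟶ B) (b' : C' ⟶ C) (c : B ⟶ B') (c' : C ⟶ B')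
    (h : b ▷ A ≫ B ◁ f ≫ N.mul ≫ c = b' ▷ A ≫ C ◁ f' ≫ N'.mul ≫ c') :
    b ▷ A ≫ frobForm M N f ≫ A ◁ c = b' ▷ A ≫ frobForm M N' f' ≫ A ◁ c' := by
  have key : ∀ {B : V} (N : NormalisableFrobenius B) (f : A ⟶ B) (b : C' ⟶ B) (c : B ⟶ B'),
      b ▷ A ≫ frobForm M N f ≫ A ◁ c = C' ◁ M.mul† ≫ (α_ _ _ _).inv ≫ (β_ C' A).hom ▷ A ≫
        (α_ _ _ _).hom ≫ A ◁ (b ▷ A ≫ B ◁ f ≫ N.mul ≫ c) := by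
    intro B N f b c
    unfold frobForm
    have h1 := BraidedCategory.braiding_naturality_left b A
    have h2 := whisker_exchange b M.mul†
    calc _ = (b ▷ A ≫ B ◁ M.mul†) ⊗≫ (β_ B A).hom ▷ A ⊗≫ A ◁ (B ◁ f ≫ N.mul ≫ c) := by
          monoidal
      _ = C' ◁ M.mul† ⊗≫ (b ▷ A ≫ (β_ B A).hom) ▷ A ⊗≫ A ◁ (B ◁ f ≫ N.mul ≫ c) := by
          rw [← h2]; monoidal
      _ = _ := by rw [h1]; monoidal
  rw [key, key, h]

/-- A morphism `b` whose dagger is compatible with left multiplication is completely positive. -/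
lemma isCP_of_mul {B B' : V} (N : NormalisableFrobenius B) (N' : NormalisableFrobenius B')
    (b : B ⟶ B') (h : B' ◁ b ≫ N'.mul = b† ▷ B ≫ N.mul ≫ b) : IsCP N N' b := by
  -- `N.mul†` is a Kraus morphism for the identity, by `frobForm_id`; composing its output with `b`
  -- gives one for `b`.
  refine ⟨B, N.mul† ≫ B ◁ b, ?_⟩
  rw [krausForm_comp, ← frobForm_id]
  have := frobForm_eq_of_mul N N' N b (𝟙 B) (𝟙 B') b† (𝟙 B') b (by simp [h])
  simpa using this

/-- A unitary isomorphism that preserves the multiplication is completely positive. -/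
lemma isCP_of_unitary {B B' : V} (N : NormalisableFrobenius B) (N' : NormalisableFrobenius B')
    (b : B ≅ B') (hb : b.hom† = b.inv) (h : N.mul ≫ b.hom = (b.hom ⊗ₘ b.hom) ≫ N'.mul) :
    IsCP N N' b.hom := by
  refine isCP_of_mul N N' b.hom ?_
  rw [hb, h, MonoidalCategory.tensorHom_def]
  simp

/-- Each constituent of the form (comultiplication, crossing, multiplication) splits into its two
factors after interchange, and adjacent interchange isomorphisms cancel. -/
lemma frobForm_tensor {A B A' B' : V} (M : NormalisableFrobenius A) (N : NormalisableFrobenius B)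
    (M' : NormalisableFrobenius A') (N' : NormalisableFrobenius B') (f : A ⟶ B) (f' : A' ⟶ B') :
    frobForm (M.tensor M') (N.tensor N') (f ⊗ₘ f') =
      tensorμ B B' A A' ≫ (frobForm M N f ⊗ₘ frobForm M' N' f') ≫ tensorδ A A' B B' := by
  have h1 := tensorδ_associator_inv B B' A A' A A'
  have h2 := tensorδ_associator_hom A A' B B' A A'
  have e1 : (M.tensor M').mul† = (M.mul† ⊗ₘ M'.mul†) ≫ tensorδ A A' A A' := by
    change (tensorμ A A' A A' ≫ (M.mul ⊗ₘ M'.mul))† = _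
    rw [DaggerCategory.dagger_comp, dagger_tensorμ, DaggerMonoidalCategory.dagger_tensor]
  have e2 : (N.tensor N').mul = tensorμ B B' B B' ≫ (N.mul ⊗ₘ N'.mul) := rfl
  have e3 : tensorδ B B' A A' ≫ (B ⊗ B') ◁ (f ⊗ₘ f') ≫ (N.tensor N').mul =
      (B ◁ f ≫ N.mul) ⊗ₘ (B' ◁ f' ≫ N'.mul) := by
    rw [e2, tensorμ_natural_right_assoc, tensorδ_tensorμ_assoc, tensorHom_comp_tensorHom]
  unfold frobForm
  calc _ = ((B ⊗ B') ◁ (M.mul† ⊗ₘ M'.mul†)) ≫ (B ⊗ B') ◁ tensorδ A A' A A' ≫ (α_ _ _ _).inv ≫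
        (β_ (B ⊗ B') (A ⊗ A')).hom ▷ (A ⊗ A') ≫ (α_ _ _ _).hom ≫
          (A ⊗ A') ◁ ((B ⊗ B') ◁ (f ⊗ₘ f') ≫ (N.tensor N').mul) := by
        rw [e1, MonoidalCategory.whiskerLeft_comp, Category.assoc]
    _ = tensorμ B B' A A' ≫ (B ◁ M.mul† ⊗ₘ B' ◁ M'.mul†) ≫ ((α_ _ _ _).inv ⊗ₘ (α_ _ _ _).inv) ≫
        tensorδ _ _ _ _ ≫ (tensorδ B B' A A' ≫ (β_ (B ⊗ B') (A ⊗ A')).hom) ▷ (A ⊗ A') ≫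
          (α_ _ _ _).hom ≫ (A ⊗ A') ◁ ((B ⊗ B') ◁ (f ⊗ₘ f') ≫ (N.tensor N').mul) := by
        rw [whiskerLeft_tensor_factors]
        simp only [Category.assoc, comp_whiskerRight]
        rw [reassoc_of% h1]
    _ = tensorμ B B' A A' ≫ (B ◁ M.mul† ⊗ₘ B' ◁ M'.mul†) ≫ ((α_ _ _ _).inv ⊗ₘ (α_ _ _ _).inv) ≫
        ((β_ B A).hom ▷ A ⊗ₘ (β_ B' A').hom ▷ A') ≫ ((α_ _ _ _).hom ⊗ₘ (α_ _ _ _).hom) ≫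
        tensorδ _ _ _ _ ≫ (A ⊗ A') ◁ (tensorδ B B' A A' ≫ (B ⊗ B') ◁ (f ⊗ₘ f') ≫
          (N.tensor N').mul) := by
        rw [tensorδ_braiding, comp_whiskerRight, Category.assoc,
          reassoc_of% tensorδ_natural_left, reassoc_of% h2,
          MonoidalCategory.whiskerLeft_comp (A ⊗ A') (tensorδ B B' A A')]
    _ = _ := by
        rw [e3, tensorδ_natural_right]
        simp only [tensorHom_comp_tensorHom_assoc]

lemma krausForm_tensor {A X B A' X' B' : V} (g : A ⟶ X ⊗ B) (g' : A' ⟶ X' ⊗ B') :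
    krausForm ((g ⊗ₘ g') ≫ tensorδ X X' B B') =
      tensorμ B B' A A' ≫ (krausForm g ⊗ₘ krausForm g') ≫ tensorδ A A' B B' := by
  have h1 := tensorδ_associator_inv B B' X X' B B'
  unfold krausForm
  rw [DaggerCategory.dagger_comp, dagger_tensorδ, DaggerMonoidalCategory.dagger_tensor,
    MonoidalCategory.whiskerLeft_comp, whiskerLeft_tensor_factors]
  simp only [Category.assoc]
  rw [reassoc_of% h1]
  simp only [← comp_whiskerRight]
  rw [reassoc_of% tensorδ_braiding, tensorδ_tensorμ_assoc, tensorHom_comp_tensorHom,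
    tensorδ_natural_left]
  simp only [tensorHom_comp_tensorHom_assoc, comp_whiskerRight]

lemma isCP_tensor {A B A' B' : V} {M : NormalisableFrobenius A} {N : NormalisableFrobenius B}
    {M' : NormalisableFrobenius A'} {N' : NormalisableFrobenius B'} {f : A ⟶ B} {f' : A' ⟶ B'}
    (h : IsCP M N f) (h' : IsCP M' N' f') : IsCP (M.tensor M') (N.tensor N') (f ⊗ₘ f') := by
  obtain ⟨X, g, hg⟩ := h
  obtain ⟨X', g', hg'⟩ := h'
  exact ⟨X ⊗ X', _, by rw [frobForm_tensor, hg, hg', ← krausForm_tensor]⟩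

variable {A : V} (M : NormalisableFrobenius A)

/-- A Frobenius algebra is its own dual: the Frobenius and counit laws give the snake equation. -/
lemma cup_snake : A ◁ M.cup ≫ (α_ _ _ _).inv ≫ (M.mul ≫ M.one†) ▷ A =
    (ρ_ A).hom ≫ (λ_ A).inv := by
  rw [← M.counit_left, M.comul_eq_right]
  simp

lemma cup_snake_right : M.cup ▷ A ≫ (α_ _ _ _).hom ≫ A ◁ (M.mul ≫ M.one†) =
    (λ_ A).hom ≫ (ρ_ A).inv := by
  rw [← M.counit_right, M.comul_eq_left]
  simp

/-- Symmetry of the form absorbs the crossing, leaving a snake. So every positive morphism `b† ≫ b`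
with `b` out of `A` is a Kraus form, by `krausForm_comp`. -/
lemma krausForm_cup : krausForm M.cup = (ρ_ A).hom ≫ (λ_ A).inv := by
  unfold krausForm
  rw [← cup_snake M]
  have h := M.form_symm
  have hd : M.cup† = M.mul ≫ M.one† := by
    simp [NormalisableFrobenius.cup, DaggerCategory.dagger_comp, DaggerCategory.dagger_dagger]
  rw [hd, ← comp_whiskerRight, h]

lemma frobenius_left : M.mul ≫ M.mul† = M.mul† ▷ A ≫ (α_ _ _ _).hom ≫ A ◁ M.mul := by
  have h := whisker_exchange M.cup M.mul
  rw [M.comul_eq_left]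
  calc _ = 𝟙 _ ⊗≫ (𝟙_ V ◁ M.mul ≫ M.cup ▷ A) ⊗≫ A ◁ M.mul := by monoidal
    _ = 𝟙 _ ⊗≫ M.cup ▷ (A ⊗ A) ⊗≫ A ◁ ((α_ A A A).hom ≫ A ◁ M.mul ≫ M.mul) := by
        rw [h]; monoidal
    _ = _ := by rw [← M.mul_assoc']; monoidal

/-- Up to the unitor, the right side is `h ≫ h†` for `h = (β_ A A).hom ≫ M.mul`. This positivity is
what makes the cup completely positive. -/
lemma op_tensor_mul_cup :
    (A ⊗ A) ◁ M.cup ≫ (M.op.tensor M).mul =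
      (ρ_ _).hom ≫ (β_ A A).hom ≫ M.mul ≫ M.mul† ≫ (β_ A A).hom := by
  change _ ◁ _ ≫ tensorμ A A A A ≫ (((β_ A A).hom ≫ M.mul) ⊗ₘ M.mul) = _
  have h1 := BraidedCategory.braiding_naturality_right A M.mul
  have h2 := BraidedCategory.braiding_naturality_right A M.mul†
  calc _ = 𝟙 _ ⊗≫ A ◁ (A ◁ M.cup ≫ (α_ _ _ _).inv ≫ (β_ A A).hom ▷ A ≫ (α_ _ _ _).hom ≫
        A ◁ M.mul) ⊗≫ ((β_ A A).hom ≫ M.mul) ▷ A := by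
        rw [tensorHom_def', tensorμ]; monoidal
    _ = (ρ_ _).hom ≫ A ◁ M.mul† ≫ (A ◁ (β_ A A).hom ≫ (α_ _ _ _).inv ≫ (β_ A A).hom ▷ A) ≫
        M.mul ▷ A := by rw [swap_one_left]; monoidal
    _ = _ := by
        rw [← braiding_right_braiding_right, reassoc_of% frobenius_left, h1, ← reassoc_of% h2]
        simp only [Category.assoc]

lemma isCP_cup : IsCP (NormalisableFrobenius.unit V) (M.op.tensor M) M.cup := by
  refine ⟨A, M.cup ≫ A ◁ (M.mul† ≫ (β_ A A).hom), ?_⟩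
  rw [krausForm_comp, krausForm_cup]
  have h := op_tensor_mul_cup M
  unfold frobForm
  rw [h]
  have e : (NormalisableFrobenius.unit V).mul = (λ_ (𝟙_ V)).hom := rfl
  rw [e, DaggerMonoidalCategory.dagger_leftUnitor, DaggerCategory.dagger_comp,
    DaggerCategory.dagger_dagger, dagger_braiding_hom, braiding_tensorUnit_right]
  monoidal

end CompletePositivity

/-! ### The dagger compact structure of CP*[V] and the forgetful functor. -/

section Monoidal

variable {V : Type u} [Category.{v} V] [MonoidalCategory V] [SymmetricCategory V]
  [DaggerCategory V] [DaggerMonoidalCategory V] [DaggerCompactCategory V]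

namespace CPStar

lemma Hom.isCP {A B : CPStar V} (f : A ⟶ B) : IsCP A.frob B.frob f.hom :=
  (isCompletelyPositive_iff _ _ _).1 f.cp

/-- A completely positive morphism, as a morphism of `CPStar V`. -/
def ofIsCP {A B : CPStar V} (f : A.X ⟶ B.X) (h : IsCP A.frob B.frob f) : A ⟶ B :=
  ⟨f, (isCompletelyPositive_iff _ _ _).2 h⟩

/-- A unitary algebra isomorphism, as an isomorphism of `CPStar V`. -/
def isoOfUnitary {A B : CPStar V} (b : A.X ≅ B.X) (hb : b.hom† = b.inv)
    (h : A.frob.mul ≫ b.hom = (b.hom ⊗ₘ b.hom) ≫ B.frob.mul) : A ≅ B where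
  hom := ofIsCP b.hom (isCP_of_unitary _ _ b hb h)
  inv := ofIsCP b.inv (hb ▸ isCP_dagger (isCP_of_unitary _ _ b hb h))
  hom_inv_id := Hom.ext b.hom_inv_id
  inv_hom_id := Hom.ext b.inv_hom_id

scoped instance monoidalCategoryStruct : MonoidalCategoryStruct (CPStar V) where
  tensorObj A B := ⟨A.X ⊗ B.X, A.frob.tensor B.frob⟩
  whiskerLeft A _ _ f := ofIsCP (A.X ◁ f.hom) (by
    rw [← id_tensorHom]; exact isCP_tensor (Hom.isCP (𝟙 A)) f.isCP)
  whiskerRight f A := ofIsCP (f.hom ▷ A.X) (by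
    rw [← tensorHom_id]; exact isCP_tensor f.isCP (Hom.isCP (𝟙 A)))
  tensorHom f g := ofIsCP (f.hom ⊗ₘ g.hom) (isCP_tensor f.isCP g.isCP)
  tensorUnit := ⟨𝟙_ V, NormalisableFrobenius.unit V⟩
  associator A B C := isoOfUnitary (α_ A.X B.X C.X)
    (DaggerMonoidalCategory.dagger_associator _ _ _)
    (@MonObj.mul_associator _ _ _ _ _ _ _ A.frob.toMonObj B.frob.toMonObj C.frob.toMonObj)
  leftUnitor A := isoOfUnitary (λ_ A.X) (DaggerMonoidalCategory.dagger_leftUnitor _)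
    (@MonObj.mul_leftUnitor _ _ _ _ _ A.frob.toMonObj)
  rightUnitor A := isoOfUnitary (ρ_ A.X) (DaggerMonoidalCategory.dagger_rightUnitor _)
    (@MonObj.mul_rightUnitor _ _ _ _ _ A.frob.toMonObj)

-- The forgetful functor is faithful and preserves all the structure on the nose, so each axiom is
-- the one in `V`.
scoped instance monoidalCategory : MonoidalCategory (CPStar V) where
  tensorHom_def f g := Hom.ext (MonoidalCategory.tensorHom_def f.hom g.hom)
  id_tensorHom_id A B := Hom.ext (id_tensorHom_id A.X B.X)
  tensorHom_comp_tensorHom f₁ f₂ g₁ g₂ :=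
    Hom.ext (tensorHom_comp_tensorHom f₁.hom f₂.hom g₁.hom g₂.hom)
  whiskerLeft_id A B := Hom.ext (MonoidalCategory.whiskerLeft_id A.X B.X)
  id_whiskerRight A B := Hom.ext (id_whiskerRight A.X B.X)
  associator_naturality f g h := Hom.ext (associator_naturality f.hom g.hom h.hom)
  leftUnitor_naturality f := Hom.ext (leftUnitor_naturality f.hom)
  rightUnitor_naturality f := Hom.ext (rightUnitor_naturality f.hom)
  pentagon A B C D := Hom.ext (pentagon A.X B.X C.X D.X)
  triangle A B := Hom.ext (triangle A.X B.X)

scoped instance symmetricCategory : SymmetricCategory (CPStar V) where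
  braiding A B := isoOfUnitary (β_ A.X B.X) (DaggerMonoidalCategory.dagger_braiding _ _)
    (@MonObj.mul_braiding _ _ _ _ _ _ A.frob.toMonObj B.frob.toMonObj)
  braiding_naturality_right A _ _ f :=
    Hom.ext (BraidedCategory.braiding_naturality_right A.X f.hom)
  braiding_naturality_left f A := Hom.ext (BraidedCategory.braiding_naturality_left f.hom A.X)
  hexagon_forward A B C := Hom.ext (BraidedCategory.hexagon_forward A.X B.X C.X)
  hexagon_reverse A B C := Hom.ext (BraidedCategory.hexagon_reverse A.X B.X C.X)
  symmetry A B := Hom.ext (SymmetricCategory.symmetry A.X B.X)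

scoped instance daggerMonoidalCategory : DaggerMonoidalCategory (CPStar V) where
  dagger_tensor f g := Hom.ext (DaggerMonoidalCategory.dagger_tensor f.hom g.hom)
  dagger_associator A B C := Hom.ext (DaggerMonoidalCategory.dagger_associator A.X B.X C.X)
  dagger_leftUnitor A := Hom.ext (DaggerMonoidalCategory.dagger_leftUnitor A.X)
  dagger_rightUnitor A := Hom.ext (DaggerMonoidalCategory.dagger_rightUnitor A.X)
  dagger_braiding A B := Hom.ext (DaggerMonoidalCategory.dagger_braiding A.X B.X)

/-- The opposite algebra, which is the dual object. -/
def op (A : CPStar V) : CPStar V := ⟨A.X, A.frob.op⟩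

/-- The cup of the underlying Frobenius algebra, as the unit of the duality of `A` and `op A`. -/
def cup (A : CPStar V) : 𝟙_ (CPStar V) ⟶ op A ⊗ A := ofIsCP A.frob.cup (isCP_cup A.frob)

-- By symmetry of the form, the swapped dagger of the cup is the Frobenius form itself, so the snake
-- equations are those of the Frobenius self-duality.
scoped instance (A : CPStar V) : ExactPairing (op A) A where
  coevaluation' := cup A
  evaluation' := (β_ A (op A)).hom ≫ (cup A)†
  coevaluation_evaluation' := Hom.ext (by
    have hd : (β_ A.X A.X).hom ≫ A.frob.cup† = A.frob.mul ≫ A.frob.one† := by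
      rw [NormalisableFrobenius.cup, DaggerCategory.dagger_comp, DaggerCategory.dagger_dagger,
        A.frob.form_symm]
    have h := cup_snake A.frob
    rw [← hd] at h
    exact h)
  evaluation_coevaluation' := Hom.ext (by
    have hd : (β_ A.X A.X).hom ≫ A.frob.cup† = A.frob.mul ≫ A.frob.one† := by
      rw [NormalisableFrobenius.cup, DaggerCategory.dagger_comp, DaggerCategory.dagger_dagger,
        A.frob.form_symm]
    have h := cup_snake_right A.frob
    rw [← hd] at h
    exact h)

scoped instance daggerCompactCategory : DaggerCompactCategory (CPStar V) where
  leftDual A := ⟨op A⟩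
  counit_eq _ := rfl

variable (V) in
/-- The strict monoidal structure of the forgetful functor. -/
def forgetCoreMonoidal : (forget V).CoreMonoidal where
  εIso := Iso.refl (𝟙_ V)
  μIso A B := Iso.refl (A.X ⊗ B.X)
  μIso_hom_natural_left f A :=
    (Category.comp_id (f.hom ▷ A.X)).trans (Category.id_comp (f.hom ▷ A.X)).symm
  μIso_hom_natural_right A f :=
    (Category.comp_id (A.X ◁ f.hom)).trans (Category.id_comp (A.X ◁ f.hom)).symm
  associativity A B C := by
    change 𝟙 (A.X ⊗ B.X) ▷ C.X ≫ 𝟙 ((A.X ⊗ B.X) ⊗ C.X) ≫ (α_ A.X B.X C.X).hom =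
      (α_ A.X B.X C.X).hom ≫ A.X ◁ 𝟙 (B.X ⊗ C.X) ≫ 𝟙 (A.X ⊗ B.X ⊗ C.X)
    simp
  left_unitality A := by
    change (λ_ A.X).hom = 𝟙 (𝟙_ V) ▷ A.X ≫ 𝟙 (𝟙_ V ⊗ A.X) ≫ (λ_ A.X).hom
    simp
  right_unitality A := by
    change (ρ_ A.X).hom = A.X ◁ 𝟙 (𝟙_ V) ≫ 𝟙 (A.X ⊗ 𝟙_ V) ≫ (ρ_ A.X).hom
    simp

scoped instance forgetBraided : (forget V).Braided where
  toMonoidal := (forgetCoreMonoidal V).toMonoidal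
  braided A B :=
    (Category.id_comp (β_ A.X B.X).hom).trans (Category.comp_id (β_ A.X B.X).hom).symm

lemma forget_structure : (Functor.LaxMonoidal.ε (CPStar.forget V))† =
      Functor.OplaxMonoidal.η (CPStar.forget V) ∧
    ∀ A B : CPStar V,
      (Functor.LaxMonoidal.μ (CPStar.forget V) A B)† =
        Functor.OplaxMonoidal.δ (CPStar.forget V) A B ∧
      tensorμ A.X B.X A.X B.X ≫ (A.frob.mul ⊗ₘ B.frob.mul) ≫
          Functor.LaxMonoidal.μ (CPStar.forget V) A B =
        (Functor.LaxMonoidal.μ (CPStar.forget V) A B ⊗ₘ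
          Functor.LaxMonoidal.μ (CPStar.forget V) A B) ≫ (A ⊗ B).frob.mul ∧
      (A.frob.normaliser ⊗ₘ B.frob.normaliser) ≫
          Functor.LaxMonoidal.μ (CPStar.forget V) A B =
        Functor.LaxMonoidal.μ (CPStar.forget V) A B ≫ (A ⊗ B).frob.normaliser := by
  refine ⟨DaggerCategory.dagger_id (𝟙_ V), fun A B => ⟨DaggerCategory.dagger_id (A.X ⊗ B.X),
    ?_, ?_⟩⟩
  · change tensorμ A.X B.X A.X B.X ≫ (A.frob.mul ⊗ₘ B.frob.mul) ≫ 𝟙 (A.X ⊗ B.X) =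
      (𝟙 (A.X ⊗ B.X) ⊗ₘ 𝟙 (A.X ⊗ B.X)) ≫
        tensorμ A.X B.X A.X B.X ≫ (A.frob.mul ⊗ₘ B.frob.mul)
    simp
  · exact (Category.comp_id (A.frob.normaliser ⊗ₘ B.frob.normaliser)).trans
      (Category.id_comp (A.frob.normaliser ⊗ₘ B.frob.normaliser)).symm

end CPStar

end Monoidal

/-! ### Dagger biproducts and their interaction with the tensor product. -/

lemma dagger_injective {C : Type u} [Category.{v} C] [DaggerCategory C] {X Y : C} {f g : X ⟶ Y}
    (h : f† = g†) : f = g := by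
  rw [← DaggerCategory.dagger_dagger f, h, DaggerCategory.dagger_dagger]

lemma IsZeroMorphism.eq_zero {C : Type u} [Category.{v} C] [Limits.HasZeroMorphisms C]
    {X Y : C} {f : X ⟶ Y} (hf : IsZeroMorphism f) : f = 0 := by
  obtain ⟨Z, a, b, hZ, rfl⟩ := hf
  rw [hZ.eq_of_tgt a 0, Limits.zero_comp]

lemma dagger_zero {C : Type u} [Category.{v} C] [DaggerCategory C] [Limits.HasZeroMorphisms C]
    (X Y : C) : (0 : X ⟶ Y)† = 0 := by
  have h := DaggerCategory.dagger_comp ((0 : Y ⟶ X)†) (0 : Y ⟶ Y)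
  rwa [DaggerCategory.dagger_dagger, Limits.comp_zero, Limits.comp_zero] at h

namespace IsDaggerBiproduct

section Universal

variable {C : Type u} [Category.{v} C] [DaggerCategory C] {A B P T : C} {i : A ⟶ P} {j : B ⟶ P}

lemma hom_ext (h : IsDaggerBiproduct i j) {f g : T ⟶ P} (hi : f ≫ i† = g ≫ i†)
    (hj : f ≫ j† = g ≫ j†) : f = g :=
  Limits.BinaryFan.IsLimit.hom_ext h.isProduct.some hi hj

lemma desc_ext (h : IsDaggerBiproduct i j) {f g : P ⟶ T} (hi : i ≫ f = i ≫ g)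
    (hj : j ≫ f = j ≫ g) : f = g :=
  Limits.BinaryCofan.IsColimit.hom_ext h.isCoproduct.some hi hj

/-- The pairing of two morphisms into a dagger biproduct. -/
def lift (h : IsDaggerBiproduct i j) (f : T ⟶ A) (g : T ⟶ B) : T ⟶ P :=
  h.isProduct.some.lift (Limits.BinaryFan.mk f g)

lemma lift_fst (h : IsDaggerBiproduct i j) (f : T ⟶ A) (g : T ⟶ B) : h.lift f g ≫ i† = f :=
  h.isProduct.some.fac (Limits.BinaryFan.mk f g) ⟨Limits.WalkingPair.left⟩

lemma lift_snd (h : IsDaggerBiproduct i j) (f : T ⟶ A) (g : T ⟶ B) : h.lift f g ≫ j† = g :=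
  h.isProduct.some.fac (Limits.BinaryFan.mk f g) ⟨Limits.WalkingPair.right⟩

/-- The copairing of two morphisms out of a dagger biproduct. -/
def desc (h : IsDaggerBiproduct i j) (f : A ⟶ T) (g : B ⟶ T) : P ⟶ T :=
  h.isCoproduct.some.desc (Limits.BinaryCofan.mk f g)

lemma inl_desc (h : IsDaggerBiproduct i j) (f : A ⟶ T) (g : B ⟶ T) : i ≫ h.desc f g = f :=
  h.isCoproduct.some.fac (Limits.BinaryCofan.mk f g) ⟨Limits.WalkingPair.left⟩

lemma inr_desc (h : IsDaggerBiproduct i j) (f : A ⟶ T) (g : B ⟶ T) : j ≫ h.desc f g = g :=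
  h.isCoproduct.some.fac (Limits.BinaryCofan.mk f g) ⟨Limits.WalkingPair.right⟩

/-- A dagger biproduct from the universal property of the product alone. -/
lemma of_product (hl : ∀ {T : C} (f : T ⟶ A) (g : T ⟶ B), ∃ h : T ⟶ P, h ≫ i† = f ∧ h ≫ j† = g)
    (hu : ∀ {T : C} (f g : T ⟶ P), f ≫ i† = g ≫ i† → f ≫ j† = g ≫ j† → f = g)
    (hi : i ≫ i† = 𝟙 A) (hj : j ≫ j† = 𝟙 B) (hij : IsZeroMorphism (i ≫ j†))
    (hji : IsZeroMorphism (j ≫ i†)) : IsDaggerBiproduct i j where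
  isProduct := ⟨Limits.BinaryFan.isLimitMk (fun s => (hl s.fst s.snd).choose)
    (fun s => (hl s.fst s.snd).choose_spec.1) (fun s => (hl s.fst s.snd).choose_spec.2)
    (fun s m h₁ h₂ => hu _ _ (h₁.trans (hl s.fst s.snd).choose_spec.1.symm)
      (h₂.trans (hl s.fst s.snd).choose_spec.2.symm))⟩
  isCoproduct := by
    -- The dagger turns a cocone on `A` and `B` into a cone, so copairings are daggers of pairings.
    have hl' : ∀ {T : C} (f : A ⟶ T) (g : B ⟶ T), ∃ h : P ⟶ T, i ≫ h = f ∧ j ≫ h = g := by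
      intro T f g
      obtain ⟨h, h₁, h₂⟩ := hl f† g†
      refine ⟨h†, dagger_injective ?_, dagger_injective ?_⟩ <;>
        simp only [DaggerCategory.dagger_comp, DaggerCategory.dagger_dagger, h₁, h₂]
    refine ⟨Limits.BinaryCofan.isColimitMk (fun s => (hl' s.inl s.inr).choose)
      (fun s => (hl' s.inl s.inr).choose_spec.1) (fun s => (hl' s.inl s.inr).choose_spec.2)
      (fun s m h₁ h₂ => dagger_injective (hu _ _ ?_ ?_))⟩
    · rw [← DaggerCategory.dagger_comp, ← DaggerCategory.dagger_comp, h₁,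
        (hl' s.inl s.inr).choose_spec.1]
    · rw [← DaggerCategory.dagger_comp, ← DaggerCategory.dagger_comp, h₂,
        (hl' s.inl s.inr).choose_spec.2]
  inl_fst := hi
  inr_snd := hj
  inl_snd := hij
  inr_fst := hji

lemma symm (h : IsDaggerBiproduct i j) : IsDaggerBiproduct j i :=
  of_product (fun f g => ⟨h.lift g f, h.lift_snd g f, h.lift_fst g f⟩)
    (fun _ _ h₁ h₂ => h.hom_ext h₂ h₁) h.inr_snd h.inl_fst h.inr_fst h.inl_snd

variable [Limits.HasZeroMorphisms C]

lemma inl_snd_eq_zero (h : IsDaggerBiproduct i j) : i ≫ j† = 0 := h.inl_snd.eq_zero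

lemma inr_fst_eq_zero (h : IsDaggerBiproduct i j) : j ≫ i† = 0 := h.inr_fst.eq_zero

/-- The block-diagonal morphism between dagger biproducts. -/
lemma exists_map {A' B' P' : C} {i' : A' ⟶ P'} {j' : B' ⟶ P'} (h : IsDaggerBiproduct i j)
    (h' : IsDaggerBiproduct i' j') (a : A ⟶ A') (b : B ⟶ B') :
    ∃ f : P ⟶ P', f ≫ i'† = i† ≫ a ∧ f ≫ j'† = j† ≫ b ∧ i ≫ f = a ≫ i' ∧ j ≫ f = b ≫ j' := by
  have h₁ := h'.lift_fst (i† ≫ a) (j† ≫ b)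
  have h₂ := h'.lift_snd (i† ≫ a) (j† ≫ b)
  refine ⟨_, h₁, h₂, h'.hom_ext ?_ ?_, h'.hom_ext ?_ ?_⟩ <;> simp only [Category.assoc]
  · rw [h₁, reassoc_of% h.inl_fst, h'.inl_fst, Category.comp_id]
  · rw [h₂, reassoc_of% h.inl_snd_eq_zero, h'.inl_snd_eq_zero, Limits.zero_comp, Limits.comp_zero]
  · rw [h₁, reassoc_of% h.inr_fst_eq_zero, h'.inr_fst_eq_zero, Limits.zero_comp, Limits.comp_zero]
  · rw [h₂, reassoc_of% h.inr_snd, h'.inr_snd, Category.comp_id]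

end Universal

section Tensor

variable {V : Type u} [Category.{v} V] [MonoidalCategory V] [SymmetricCategory V]
  [DaggerCategory V] [DaggerMonoidalCategory V] [DaggerCompactCategory V]
  {A B P A' B' P' T : V} {i : A ⟶ P} {j : B ⟶ P} {i' : A' ⟶ P'} {j' : B' ⟶ P'}

/-- Tensoring with `X` is left adjoint to tensoring with `ᘁX`, so it keeps the injections jointly
epic. -/
lemma whiskerLeft_desc_ext (h : IsDaggerBiproduct i j) (X : V) {f g : X ⊗ P ⟶ T}
    (hi : X ◁ i ≫ f = X ◁ i ≫ g) (hj : X ◁ j ≫ f = X ◁ j ≫ g) : f = g := by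
  obtain ⟨f, rfl⟩ := (tensorLeftHomEquiv P (ᘁX : V) X T).symm.surjective f
  obtain ⟨g, rfl⟩ := (tensorLeftHomEquiv P (ᘁX : V) X T).symm.surjective g
  rw [← tensorLeftHomEquiv_symm_naturality, ← tensorLeftHomEquiv_symm_naturality] at hi hj
  rw [h.desc_ext ((tensorLeftHomEquiv A (ᘁX : V) X T).symm.injective hi)
    ((tensorLeftHomEquiv B (ᘁX : V) X T).symm.injective hj)]

lemma whiskerRight_desc_ext (h : IsDaggerBiproduct i j) (X : V) {f g : P ⊗ X ⟶ T}
    (hi : i ▷ X ≫ f = i ▷ X ≫ g) (hj : j ▷ X ≫ f = j ▷ X ≫ g) : f = g := by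
  rw [← cancel_epi (β_ X P).hom]
  apply h.whiskerLeft_desc_ext X
  · rw [BraidedCategory.braiding_naturality_right_assoc, hi,
      BraidedCategory.braiding_naturality_right_assoc]
  · rw [BraidedCategory.braiding_naturality_right_assoc, hj,
      BraidedCategory.braiding_naturality_right_assoc]

lemma whiskerLeft_hom_ext (h : IsDaggerBiproduct i j) (X : V) {f g : T ⟶ X ⊗ P}
    (hi : f ≫ X ◁ i† = g ≫ X ◁ i†) (hj : f ≫ X ◁ j† = g ≫ X ◁ j†) : f = g := by
  apply dagger_injective
  apply h.whiskerLeft_desc_ext X <;> apply dagger_injective <;>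
    simpa only [DaggerCategory.dagger_comp, DaggerCategory.dagger_dagger, dagger_whiskerLeft]

/-- Separates morphisms by their four blocks, splitting one tensor factor at a time. -/
lemma tensor_desc_ext (h : IsDaggerBiproduct i j) (h' : IsDaggerBiproduct i' j')
    {f g : P ⊗ P' ⟶ T} (hii : (i ⊗ₘ i') ≫ f = (i ⊗ₘ i') ≫ g)
    (hij : (i ⊗ₘ j') ≫ f = (i ⊗ₘ j') ≫ g) (hji : (j ⊗ₘ i') ≫ f = (j ⊗ₘ i') ≫ g)
    (hjj : (j ⊗ₘ j') ≫ f = (j ⊗ₘ j') ≫ g) : f = g := by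
  simp only [tensorHom_def', Category.assoc] at hii hij hji hjj
  exact h'.whiskerLeft_desc_ext P
    (h.whiskerRight_desc_ext A' (by simpa [whisker_exchange_assoc] using hii)
      (by simpa [whisker_exchange_assoc] using hji))
    (h.whiskerRight_desc_ext B' (by simpa [whisker_exchange_assoc] using hij)
      (by simpa [whisker_exchange_assoc] using hjj))

lemma tensor_hom_ext (h : IsDaggerBiproduct i j) (h' : IsDaggerBiproduct i' j')
    {f g : T ⟶ P ⊗ P'} (hii : f ≫ (i† ⊗ₘ i'†) = g ≫ (i† ⊗ₘ i'†))
    (hij : f ≫ (i† ⊗ₘ j'†) = g ≫ (i† ⊗ₘ j'†)) (hji : f ≫ (j† ⊗ₘ i'†) = g ≫ (j† ⊗ₘ i'†))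
    (hjj : f ≫ (j† ⊗ₘ j'†) = g ≫ (j† ⊗ₘ j'†)) : f = g := by
  apply dagger_injective
  apply h.tensor_desc_ext h' <;> apply dagger_injective <;>
    simpa only [DaggerCategory.dagger_comp, DaggerCategory.dagger_dagger,
      DaggerMonoidalCategory.dagger_tensor]

end Tensor

end IsDaggerBiproduct

/-! ### Zero objects and zero morphisms under the tensor product. -/

section Zero

variable {V : Type u} [Category.{v} V] [MonoidalCategory V] [SymmetricCategory V]
  [DaggerCategory V] [DaggerMonoidalCategory V] [DaggerCompactCategory V]

/-- The duality adjunction makes `X ⊗ Z` initial, and the dagger then makes it terminal. -/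
lemma isZero_tensor_right {Z : V} (hZ : Limits.IsZero Z) (X : V) : Limits.IsZero (X ⊗ Z) := by
  have h : ∀ {Y : V} (f g : X ⊗ Z ⟶ Y), f = g := fun f g =>
    (tensorLeftHomEquiv Z (ᘁX : V) X _).injective (hZ.eq_of_src _ _)
  exact ⟨fun Y => ⟨⟨⟨(tensorLeftHomEquiv Z (ᘁX : V) X Y).symm (hZ.to_ _)⟩,
      fun f => h _ _⟩⟩,
    fun Y => ⟨⟨⟨((tensorLeftHomEquiv Z (ᘁX : V) X Y).symm (hZ.to_ _))†⟩,
      fun f => dagger_injective (h _ _)⟩⟩⟩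

variable [Limits.HasZeroMorphisms V]

lemma whiskerLeft_zero (X Y Z : V) : X ◁ (0 : Y ⟶ Z) = 0 := by
  -- The composite does not depend on `F`, so the identity may be exchanged for zero.
  have h : ∀ {W : V} (F : X ⊗ Z ⟶ W), X ◁ (0 : Y ⟶ Z) ≫ F =
      (tensorLeftHomEquiv Y (ᘁX : V) X W).symm 0 := by
    intro W F
    obtain ⟨F, rfl⟩ := (tensorLeftHomEquiv Z (ᘁX : V) X W).symm.surjective F
    rw [← tensorLeftHomEquiv_symm_naturality, Limits.zero_comp]
  rw [← Category.comp_id (X ◁ (0 : Y ⟶ Z)), h, ← h 0, Limits.comp_zero]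

lemma zero_whiskerRight (X Y Z : V) : (0 : Y ⟶ Z) ▷ X = 0 := by
  rw [← cancel_epi (β_ X Y).hom, ← BraidedCategory.braiding_naturality_right, whiskerLeft_zero,
    Limits.zero_comp, Limits.comp_zero]

lemma tensorHom_zero {W X : V} (f : W ⟶ X) (Y Z : V) : f ⊗ₘ (0 : Y ⟶ Z) = 0 := by
  rw [MonoidalCategory.tensorHom_def, whiskerLeft_zero, Limits.comp_zero]

lemma zero_tensorHom {W X : V} (f : W ⟶ X) (Y Z : V) : (0 : Y ⟶ Z) ⊗ₘ f = 0 := by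
  rw [MonoidalCategory.tensorHom_def, zero_whiskerRight, Limits.zero_comp]

end Zero

/-! ### The block-diagonal algebra on a dagger biproduct. -/

section Biproducts

variable {V : Type u} [Category.{v} V] [MonoidalCategory V] [SymmetricCategory V]
  [DaggerCategory V] [DaggerMonoidalCategory V] [DaggerCompactCategory V]
  [Limits.HasZeroMorphisms V] {A B P : V} {i : A ⟶ P} {j : B ⟶ P}

namespace IsDaggerBiproduct

lemma tensor_inl_comp (h : IsDaggerBiproduct i j) {m : P ⊗ P ⟶ P} {a : A ⊗ A ⟶ A}
    {b : B ⊗ B ⟶ B} (ha : m ≫ i† = (i† ⊗ₘ i†) ≫ a) (hb : m ≫ j† = (j† ⊗ₘ j†) ≫ b) :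
    (i ⊗ₘ i) ≫ m = a ≫ i := by
  apply h.hom_ext <;> simp only [Category.assoc, ha, hb, tensorHom_comp_tensorHom_assoc, h.inl_fst,
    h.inl_snd_eq_zero, tensorHom_zero, id_tensorHom_id, Limits.zero_comp, Limits.comp_zero,
    Category.id_comp, Category.comp_id]

lemma tensor_inl_inr_comp (h : IsDaggerBiproduct i j) {m : P ⊗ P ⟶ P} {a : A ⊗ A ⟶ A}
    {b : B ⊗ B ⟶ B} (ha : m ≫ i† = (i† ⊗ₘ i†) ≫ a) (hb : m ≫ j† = (j† ⊗ₘ j†) ≫ b) :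
    (i ⊗ₘ j) ≫ m = 0 := by
  apply h.hom_ext <;> simp only [Category.assoc, ha, hb, tensorHom_comp_tensorHom_assoc,
    h.inl_snd_eq_zero, h.inr_fst_eq_zero, tensorHom_zero, zero_tensorHom, Limits.zero_comp]

/-- The components of the comultiplication dual to a block-diagonal multiplication. -/
lemma comul_comp_tensor (h : IsDaggerBiproduct i j) {m : P ⊗ P ⟶ P} {a : A ⊗ A ⟶ A}
    {b : B ⊗ B ⟶ B} (ha : m ≫ i† = (i† ⊗ₘ i†) ≫ a) (hb : m ≫ j† = (j† ⊗ₘ j†) ≫ b) :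
    m† ≫ (i† ⊗ₘ i†) = i† ≫ a† ∧ m† ≫ (i† ⊗ₘ j†) = 0 := by
  rw [← DaggerMonoidalCategory.dagger_tensor, ← DaggerMonoidalCategory.dagger_tensor,
    ← DaggerCategory.dagger_comp, ← DaggerCategory.dagger_comp, ← DaggerCategory.dagger_comp,
    h.tensor_inl_comp ha hb, h.tensor_inl_inr_comp ha hb, dagger_zero]
  exact ⟨rfl, rfl⟩

/-- Both sides of the Frobenius law for a block-diagonal multiplication are block-diagonal. -/
lemma frobenius_components (h : IsDaggerBiproduct i j) {m : P ⊗ P ⟶ P} {a : A ⊗ A ⟶ A}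
    {b : B ⊗ B ⟶ B} (ha : m ≫ i† = (i† ⊗ₘ i†) ≫ a) (hb : m ≫ j† = (j† ⊗ₘ j†) ≫ b) :
    ((P ◁ m† ≫ (α_ _ _ _).inv ≫ m ▷ P) ≫ (i† ⊗ₘ i†) =
        (i† ⊗ₘ i†) ≫ A ◁ a† ≫ (α_ _ _ _).inv ≫ a ▷ A ∧
      (P ◁ m† ≫ (α_ _ _ _).inv ≫ m ▷ P) ≫ (i† ⊗ₘ j†) = 0) ∧
    ((m† ▷ P ≫ (α_ _ _ _).hom ≫ P ◁ m) ≫ (i† ⊗ₘ i†) =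
        (i† ⊗ₘ i†) ≫ a† ▷ A ≫ (α_ _ _ _).hom ≫ A ◁ a ∧
      (m† ▷ P ≫ (α_ _ _ _).hom ≫ P ◁ m) ≫ (i† ⊗ₘ j†) = 0) := by
  obtain ⟨h₁, h₂⟩ := h.comul_comp_tensor ha hb
  -- Projecting the product to `A` projects both of its inputs, so only the `i† ⊗ₘ k` component of
  -- the comultiplication survives; it vanishes for `k = j†`.
  have e₁ : ∀ {X : V} (k : P ⟶ X), (P ◁ m† ≫ (α_ _ _ _).inv ≫ m ▷ P) ≫ (i† ⊗ₘ k) =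
      (i† ⊗ₘ m† ≫ (i† ⊗ₘ k)) ≫ (α_ _ _ _).inv ≫ a ▷ X := by
    intro X k
    have := associator_inv_naturality i† i† k
    have hs : (i† ⊗ₘ m† ≫ (i† ⊗ₘ k)) = (𝟙 P ⊗ₘ m†) ≫ (i† ⊗ₘ (i† ⊗ₘ k)) := by
      rw [tensorHom_comp_tensorHom, Category.id_comp]
    simp only [← id_tensorHom, ← tensorHom_id, tensorHom_comp_tensorHom, Category.id_comp,
      Category.assoc, ha]
    rw [hs, Category.assoc, reassoc_of% this, tensorHom_comp_tensorHom, Category.comp_id]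
  have e₂ : ∀ {X Y : V} (k : P ⟶ X) (l : P ⟶ Y) {c : Y ⊗ Y ⟶ Y} (hc : m ≫ l = (l ⊗ₘ l) ≫ c),
      (m† ▷ P ≫ (α_ _ _ _).hom ≫ P ◁ m) ≫ (k ⊗ₘ l) =
      (m† ≫ (k ⊗ₘ l) ⊗ₘ l) ≫ (α_ _ _ _).hom ≫ X ◁ c := by
    intro X Y k l c hc
    have := associator_naturality k l l
    simp only [← id_tensorHom, ← tensorHom_id, tensorHom_comp_tensorHom, Category.id_comp,
      Category.assoc, hc]
    conv_rhs => rw [← Category.id_comp l, ← tensorHom_comp_tensorHom, Category.id_comp,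
      Category.assoc, reassoc_of% this, tensorHom_comp_tensorHom, Category.comp_id]
  refine ⟨⟨?_, ?_⟩, ?_, ?_⟩
  · rw [e₁, h₁, ← id_tensorHom A, tensorHom_comp_tensorHom_assoc, Category.comp_id]
  · rw [e₁, h₂, tensorHom_zero, Limits.zero_comp]
  · rw [e₂ _ _ ha, h₁, ← tensorHom_id _ A, tensorHom_comp_tensorHom_assoc, Category.comp_id]
  · rw [e₂ _ _ hb, h₂, zero_tensorHom, Limits.zero_comp]

lemma exists_normaliser (hV : HasDaggerBiproducts V) (h : IsDaggerBiproduct i j) {a : A ⟶ A}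
    {b : B ⟶ B} (ha : IsIso a) (hb : IsIso b) (ha' : IsPositiveMorphism a)
    (hb' : IsPositiveMorphism b) : ∃ n : P ⟶ P, n ≫ i† = i† ≫ a ∧ n ≫ j† = j† ≫ b ∧ IsIso n ∧
      IsPositiveMorphism n := by
  obtain ⟨n, h₁, h₂, h₃, h₄⟩ := h.exists_map h a b
  obtain ⟨n', h₁', h₂', -, -⟩ := h.exists_map h (inv a) (inv b)
  refine ⟨n, h₁, h₂, ⟨n', ?_, ?_⟩, ?_⟩
  · apply h.hom_ext
    · rw [Category.assoc, h₁', reassoc_of% h₁]; simp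
    · rw [Category.assoc, h₂', reassoc_of% h₂]; simp
  · apply h.hom_ext
    · rw [Category.assoc, h₁, reassoc_of% h₁']; simp
    · rw [Category.assoc, h₂, reassoc_of% h₂']; simp
  · obtain ⟨A', k, rfl⟩ := ha'
    obtain ⟨B', l, rfl⟩ := hb'
    -- The square roots `k` and `l` may have different codomains; their block sum, into a biproduct
    -- of these, is a square root of `n`.
    obtain ⟨Q, i', j', hQ⟩ := hV.2 A' B'
    obtain ⟨f, f₁, f₂, f₃, f₄⟩ := h.exists_map hQ k l
    refine ⟨Q, f, h.hom_ext ?_ ?_⟩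
    · rw [h₁, Category.assoc, ← DaggerCategory.dagger_comp, f₃, DaggerCategory.dagger_comp,
        reassoc_of% f₁]
    · rw [h₂, Category.assoc, ← DaggerCategory.dagger_comp, f₄, DaggerCategory.dagger_comp,
        reassoc_of% f₂]

/-- A dagger biproduct of normalisable dagger Frobenius algebras carries the block-diagonal
structure. -/
lemma exists_frobenius (hV : HasDaggerBiproducts V) (h : IsDaggerBiproduct i j)
    (M : NormalisableFrobenius A) (N : NormalisableFrobenius B) :
    ∃ R : NormalisableFrobenius P,
      (R.mul ≫ i† = (i† ⊗ₘ i†) ≫ M.mul ∧ R.mul ≫ j† = (j† ⊗ₘ j†) ≫ N.mul) ∧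
      (R.one ≫ i† = M.one ∧ R.one ≫ j† = N.one) ∧
      (R.normaliser ≫ i† = i† ≫ M.normaliser ∧ R.normaliser ≫ j† = j† ≫ N.normaliser) := by
  obtain ⟨m, ma, mb⟩ : ∃ m : P ⊗ P ⟶ P, m ≫ i† = (i† ⊗ₘ i†) ≫ M.mul ∧
      m ≫ j† = (j† ⊗ₘ j†) ≫ N.mul := ⟨_, h.lift_fst _ _, h.lift_snd _ _⟩
  obtain ⟨e, ea, eb⟩ : ∃ e : 𝟙_ V ⟶ P, e ≫ i† = M.one ∧ e ≫ j† = N.one :=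
    ⟨_, h.lift_fst _ _, h.lift_snd _ _⟩
  obtain ⟨n, na, nb, hn, hn'⟩ := h.exists_normaliser hV M.isIso_normaliser N.isIso_normaliser
    M.positive_normaliser N.positive_normaliser
  obtain ⟨c₁, c₂⟩ := h.comul_comp_tensor ma mb
  obtain ⟨c₃, c₄⟩ := h.symm.comul_comp_tensor mb ma
  have cup₁ : (e ≫ m†) ≫ (i† ⊗ₘ i†) = M.cup := by
    rw [Category.assoc, c₁, reassoc_of% ea, NormalisableFrobenius.cup]
  have cup₂ : (e ≫ m†) ≫ (j† ⊗ₘ j†) = N.cup := by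
    rw [Category.assoc, c₃, reassoc_of% eb, NormalisableFrobenius.cup]
  have cup₃ : (e ≫ m†) ≫ (i† ⊗ₘ j†) = 0 := by rw [Category.assoc, c₂, Limits.comp_zero]
  have cup₄ : (e ≫ m†) ≫ (j† ⊗ₘ i†) = 0 := by rw [Category.assoc, c₄, Limits.comp_zero]
  -- The braiding exchanges the two off-diagonal components, both of which are zero.
  have hs : (e ≫ m†) ≫ (β_ P P).hom = e ≫ m† := by
    apply h.tensor_hom_ext h <;>
      rw [Category.assoc, ← BraidedCategory.braiding_naturality, ← Category.assoc]
    · rw [cup₁, M.cup_symm]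
    · rw [cup₄, cup₃, Limits.zero_comp]
    · rw [cup₃, cup₄, Limits.zero_comp]
    · rw [cup₂, N.cup_symm]
  -- From here each law is proved after a projection `k` that intertwines the structure maps, and is
  -- then applied to both `i†` and `j†`.
  have one_mul' : ∀ {A : V} (k : P ⟶ A) (M : NormalisableFrobenius A),
      m ≫ k = (k ⊗ₘ k) ≫ M.mul → e ≫ k = M.one → (e ▷ P ≫ m) ≫ k = (λ_ P).hom ≫ k := by
    intro A k M hm he
    rw [Category.assoc, hm, ← tensorHom_id, tensorHom_comp_tensorHom_assoc, Category.id_comp, he,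
      tensorHom_def', Category.assoc, M.one_mul', leftUnitor_naturality]
  have mul_one' : ∀ {A : V} (k : P ⟶ A) (M : NormalisableFrobenius A),
      m ≫ k = (k ⊗ₘ k) ≫ M.mul → e ≫ k = M.one → (P ◁ e ≫ m) ≫ k = (ρ_ P).hom ≫ k := by
    intro A k M hm he
    rw [Category.assoc, hm, ← id_tensorHom, tensorHom_comp_tensorHom_assoc, Category.id_comp, he,
      MonoidalCategory.tensorHom_def, Category.assoc, M.mul_one', rightUnitor_naturality]
  have mul_assoc' : ∀ {A : V} (k : P ⟶ A) (M : NormalisableFrobenius A),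
      m ≫ k = (k ⊗ₘ k) ≫ M.mul →
        (m ▷ P ≫ m) ≫ k = ((α_ P P P).hom ≫ P ◁ m ≫ m) ≫ k := by
    intro A k M hm
    have h₁ : (m ▷ P ≫ m) ≫ k = ((k ⊗ₘ k) ⊗ₘ k) ≫ M.mul ▷ A ≫ M.mul := by
      rw [Category.assoc, hm, ← tensorHom_id, ← tensorHom_id, tensorHom_comp_tensorHom_assoc,
        tensorHom_comp_tensorHom_assoc, hm, Category.id_comp, Category.comp_id]
    have h₂ : (P ◁ m ≫ m) ≫ k = (k ⊗ₘ (k ⊗ₘ k)) ≫ A ◁ M.mul ≫ M.mul := by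
      rw [Category.assoc, hm, ← id_tensorHom, ← id_tensorHom, tensorHom_comp_tensorHom_assoc,
        tensorHom_comp_tensorHom_assoc, hm, Category.id_comp, Category.comp_id]
    rw [h₁, M.mul_assoc', associator_naturality_assoc, ← h₂]
    simp only [Category.assoc]
  have central_left' : ∀ {A : V} (k : P ⟶ A) (M : NormalisableFrobenius A),
      m ≫ k = (k ⊗ₘ k) ≫ M.mul → n ≫ k = k ≫ M.normaliser →
        (n ▷ P ≫ m) ≫ k = (m ≫ n) ≫ k := by
    intro A k M hm hk
    rw [Category.assoc, Category.assoc, hk, reassoc_of% hm, hm, ← M.central_left, ← tensorHom_id,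
      ← tensorHom_id, tensorHom_comp_tensorHom_assoc, tensorHom_comp_tensorHom_assoc, hk,
      Category.id_comp, Category.comp_id]
  have central_right' : ∀ {A : V} (k : P ⟶ A) (M : NormalisableFrobenius A),
      m ≫ k = (k ⊗ₘ k) ≫ M.mul → n ≫ k = k ≫ M.normaliser →
        (P ◁ n ≫ m) ≫ k = (m ≫ n) ≫ k := by
    intro A k M hm hk
    rw [Category.assoc, Category.assoc, hk, reassoc_of% hm, hm, ← M.central_right, ← id_tensorHom,
      ← id_tensorHom, tensorHom_comp_tensorHom_assoc, tensorHom_comp_tensorHom_assoc, hk,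
      Category.id_comp, Category.comp_id]
  have cup_mul_sq' : ∀ {A : V} (k : P ⟶ A) (M : NormalisableFrobenius A),
      m ≫ k = (k ⊗ₘ k) ≫ M.mul → n ≫ k = k ≫ M.normaliser → (e ≫ m†) ≫ (k ⊗ₘ k) = M.cup →
        e ≫ k = M.one → (e ≫ m† ≫ m ≫ n ≫ n) ≫ k = e ≫ k := by
    intro A k M hm hk hc he
    have := M.cup_mul_sq
    rw [NormalisableFrobenius.sq, ← hc] at this
    simp only [Category.assoc] at this ⊢
    rw [hk, reassoc_of% hk, reassoc_of% hm, this, he]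
  have hs' : (β_ P P).hom ≫ m ≫ e† = m ≫ e† := dagger_injective (by
    simpa only [DaggerCategory.dagger_comp, DaggerCategory.dagger_dagger, dagger_braiding_hom])
  obtain ⟨⟨f₁, f₂⟩, f₃, f₄⟩ := h.frobenius_components ma mb
  obtain ⟨⟨g₁, g₂⟩, g₃, g₄⟩ := h.symm.frobenius_components mb ma
  exact ⟨SymmetricFrobenius.toNormalisable
    { one := e
      mul := m
      one_mul := h.hom_ext (one_mul' _ M ma ea) (one_mul' _ N mb eb)
      mul_one := h.hom_ext (mul_one' _ M ma ea) (mul_one' _ N mb eb)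
      mul_assoc := h.hom_ext (mul_assoc' _ M ma) (mul_assoc' _ N mb)
      frobenius := h.tensor_hom_ext h (by rw [f₁, f₃, M.frobenius]) (by rw [f₂, f₄])
        (by rw [g₂, g₄]) (by rw [g₁, g₃, N.frobenius])
      normaliser := n
      isIso_normaliser := hn
      positive_normaliser := hn'
      central_left := h.hom_ext (central_left' _ M ma na) (central_left' _ N mb nb)
      central_right := h.hom_ext (central_right' _ M ma na) (central_right' _ N mb nb)
      form_symm := hs'
      cup_mul_sq := h.hom_ext (cup_mul_sq' _ M ma na cup₁ ea) (cup_mul_sq' _ N mb nb cup₂ eb) },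
    ⟨ma, mb⟩, ⟨ea, eb⟩, na, nb⟩

end IsDaggerBiproduct

end Biproducts

/-! ### A criterion for *-homomorphisms. -/

section StarHomomorphisms

variable {V : Type u} [Category.{v} V] [MonoidalCategory V] [SymmetricCategory V]
  [DaggerCategory V] [DaggerMonoidalCategory V] [DaggerCompactCategory V] {A B : V}

lemma conj_cap (f : A ⟶ B) : conj f ▷ B ≫ cap B = (ᘁA : V) ◁ f† ≫ cap A := by
  have h := leftAdjointMate_comp_evaluation f†
  rw [cap_eq, cap_eq, BraidedCategory.braiding_naturality_left_assoc,
    BraidedCategory.braiding_naturality_right_assoc, ← h, conj]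

/-- The involution is the cup with one leg bent, so compatibility with involutions can be tested on
cups. -/
lemma involution_eq (M : NormalisableFrobenius A) : M.involution =
    (ρ_ _).inv ≫ (ᘁA : V) ◁ M.cup ≫ (α_ _ _ _).inv ≫ cap A ▷ A ≫ (λ_ A).hom := by
  simp [NormalisableFrobenius.involution, NormalisableFrobenius.coaction,
    NormalisableFrobenius.cup]

/-- A multiplicative morphism that is compatible with the cups is a *-homomorphism. -/
lemma isStarHomomorphism_of_cup (M : NormalisableFrobenius A) (N : NormalisableFrobenius B)
    (f : A ⟶ B) (h : M.mul ≫ f = (f ⊗ₘ f) ≫ N.mul) (hc : N.cup ≫ f† ▷ B = M.cup ≫ A ◁ f) :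
    IsStarHomomorphism M N f := by
  refine ⟨h, ?_⟩
  rw [involution_eq, involution_eq]
  have h₁ := whisker_exchange (conj f) N.cup
  have h₂ := whisker_exchange (cap A) f
  calc _ = (ρ_ _).inv ≫ (conj f ▷ 𝟙_ V ≫ (ᘁB : V) ◁ N.cup) ≫ (α_ _ _ _).inv ≫ cap B ▷ B ≫
        (λ_ B).hom := by simp
    _ = (ρ_ _).inv ≫ (ᘁA : V) ◁ N.cup ≫ (α_ _ _ _).inv ≫ (conj f ▷ B ≫ cap B) ▷ B ≫
        (λ_ B).hom := by rw [← h₁]; monoidal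
    _ = (ρ_ _).inv ≫ (ᘁA : V) ◁ (N.cup ≫ f† ▷ B) ≫ (α_ _ _ _).inv ≫ cap A ▷ B ≫ (λ_ B).hom := by
        rw [conj_cap]; monoidal
    _ = (ρ_ _).inv ≫ (ᘁA : V) ◁ M.cup ≫ (α_ _ _ _).inv ≫ (((ᘁA : V) ⊗ A) ◁ f ≫ cap A ▷ B) ≫
        (λ_ B).hom := by rw [hc]; monoidal
    _ = _ := by rw [h₂]; simp

end StarHomomorphisms

/-! ### Complete positivity and the biproduct maps. -/

section Biproducts

variable {V : Type u} [Category.{v} V] [MonoidalCategory V] [SymmetricCategory V]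
  [DaggerCategory V] [DaggerMonoidalCategory V] [DaggerCompactCategory V]
  [Limits.HasZeroMorphisms V] {A B P : V} {i : A ⟶ P} {j : B ⟶ P}

namespace IsDaggerBiproduct

variable {M : NormalisableFrobenius A} {N : NormalisableFrobenius B}
  {R : NormalisableFrobenius P}

/-- The cup of the block-diagonal algebra has no mixed components, so projecting one leg to `A`
forces the other into `A`. -/
lemma cup_comp_inl (h : IsDaggerBiproduct i j) (ha : R.mul ≫ i† = (i† ⊗ₘ i†) ≫ M.mul)
    (hb : R.mul ≫ j† = (j† ⊗ₘ j†) ≫ N.mul)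
    (he : R.one ≫ i† = M.one) : R.cup ≫ i† ▷ P = M.cup ≫ A ◁ i := by
  obtain ⟨h₁, h₂⟩ := h.comul_comp_tensor ha hb
  apply h.whiskerLeft_hom_ext A
  · rw [Category.assoc, Category.assoc, ← MonoidalCategory.tensorHom_def,
      ← MonoidalCategory.whiskerLeft_comp, h.inl_fst, MonoidalCategory.whiskerLeft_id,
      Category.comp_id, NormalisableFrobenius.cup, Category.assoc, h₁, reassoc_of% he,
      NormalisableFrobenius.cup]
  · rw [Category.assoc, Category.assoc, ← MonoidalCategory.tensorHom_def,
      ← MonoidalCategory.whiskerLeft_comp, h.inl_snd_eq_zero, whiskerLeft_zero,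
      NormalisableFrobenius.cup, Category.assoc, h₂, Limits.comp_zero, Limits.comp_zero]

lemma isStarHomomorphism_inl (h : IsDaggerBiproduct i j) (ha : R.mul ≫ i† = (i† ⊗ₘ i†) ≫ M.mul)
    (hb : R.mul ≫ j† = (j† ⊗ₘ j†) ≫ N.mul)
    (he : R.one ≫ i† = M.one) : IsStarHomomorphism M R i :=
  isStarHomomorphism_of_cup M R i (h.tensor_inl_comp ha hb).symm (h.cup_comp_inl ha hb he)

/-- Symmetry of both cups turns the cup condition for `i†` into the one for `i`. -/
lemma isStarHomomorphism_fst (h : IsDaggerBiproduct i j) (ha : R.mul ≫ i† = (i† ⊗ₘ i†) ≫ M.mul)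
    (hb : R.mul ≫ j† = (j† ⊗ₘ j†) ≫ N.mul)
    (he : R.one ≫ i† = M.one) : IsStarHomomorphism R M i† := by
  refine isStarHomomorphism_of_cup R M i† ha ?_
  have := h.cup_comp_inl ha hb he
  rw [DaggerCategory.dagger_dagger, ← M.cup_symm, ← R.cup_symm, Category.assoc, Category.assoc,
    ← BraidedCategory.braiding_naturality_right, ← reassoc_of% this,
    ← BraidedCategory.braiding_naturality_left]

/-- In elements, `y · i(x) = i(i†(y) · x)`, because the `B` component of `y` annihilates the image
of `i`. -/
lemma isCP_inl (h : IsDaggerBiproduct i j) (ha : R.mul ≫ i† = (i† ⊗ₘ i†) ≫ M.mul)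
    (hb : R.mul ≫ j† = (j† ⊗ₘ j†) ≫ N.mul) : IsCP M R i := by
  refine isCP_of_mul M R i (h.hom_ext ?_ ?_)
  · simp only [Category.assoc, ha, h.inl_fst, Category.comp_id, ← id_tensorHom,
      tensorHom_comp_tensorHom_assoc, Category.id_comp, tensorHom_id]
  · simp only [Category.assoc, hb, h.inl_snd_eq_zero, Limits.comp_zero, ← id_tensorHom,
      tensorHom_comp_tensorHom_assoc, tensorHom_zero, Limits.zero_comp]

lemma frobForm_diagonal (h : IsDaggerBiproduct i j) (ha : R.mul ≫ i† = (i† ⊗ₘ i†) ≫ M.mul)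
    {T : V} (S : NormalisableFrobenius T) (f : T ⟶ P) :
    i ▷ T ≫ frobForm S R f ≫ T ◁ i† = frobForm S M (f ≫ i†) := by
  rw [frobForm_eq_of_mul S R M f (f ≫ i†) i (𝟙 A) i† (𝟙 A)]
  · simp
  · rw [ha, ← MonoidalCategory.tensorHom_def_assoc, tensorHom_comp_tensorHom_assoc, h.inl_fst]
    simp

lemma frobForm_off_diagonal (h : IsDaggerBiproduct i j)
    (hb : R.mul ≫ j† = (j† ⊗ₘ j†) ≫ N.mul) {T : V} (S : NormalisableFrobenius T) (f : T ⟶ P) :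
    i ▷ T ≫ frobForm S R f ≫ T ◁ j† = 0 := by
  -- Before projection to `B`, the left factor `i` may be replaced by zero: nothing in `A`
  -- contributes to the `B` component of a product.
  rw [frobForm_eq_of_mul S R R f f i (0 : A ⟶ P) j† j†, zero_whiskerRight, Limits.zero_comp]
  rw [hb, ← MonoidalCategory.tensorHom_def_assoc, tensorHom_comp_tensorHom_assoc, h.inl_snd_eq_zero,
    zero_tensorHom, zero_whiskerRight, Limits.zero_comp, Limits.zero_comp]

/-- Embedding the ancilla by an isometry does not change the Kraus form, since `x` meets its own
dagger. -/
lemma krausForm_diagonal {T X Q : V} {x : X ⟶ Q} (hx : x ≫ x† = 𝟙 X) {g : T ⟶ X ⊗ A}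
    {G : T ⟶ Q ⊗ P} (hG : G ≫ Q ◁ i† = g ≫ x ▷ A) :
    i ▷ T ≫ krausForm G ≫ T ◁ i† = krausForm g := by
  have := sesqForm_comp G G i† i†
  rw [DaggerCategory.dagger_dagger, hG, sesqForm_whiskerRight,
    Category.assoc, ← comp_whiskerRight, hx, id_whiskerRight, Category.comp_id] at this
  exact this.symm

/-- A mixed entry joins `x` to `y†` along the ancilla wire, so orthogonal ancillas make it vanish.
-/
lemma krausForm_off_diagonal {T X Y Q : V} {x : X ⟶ Q} {y : Y ⟶ Q} (hxy : x ≫ y† = 0)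
    {g : T ⟶ X ⊗ A} {g' : T ⟶ Y ⊗ B} {G : T ⟶ Q ⊗ P} (hG : G ≫ Q ◁ i† = g ≫ x ▷ A)
    (hG' : G ≫ Q ◁ j† = g' ≫ y ▷ B) :
    i ▷ T ≫ krausForm G ≫ T ◁ j† = 0 := by
  have := sesqForm_comp G G j† i†
  rw [DaggerCategory.dagger_dagger, hG, hG', sesqForm_whiskerRight,
    Category.assoc, ← comp_whiskerRight, hxy, zero_whiskerRight, Limits.comp_zero] at this
  refine this.symm.trans ?_
  rw [sesqForm, dagger_zero, zero_whiskerRight]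
  simp only [Limits.comp_zero]

/-- The pairing of completely positive morphisms is completely positive. -/
lemma isCP_of_components (h : IsDaggerBiproduct i j) (ha : R.mul ≫ i† = (i† ⊗ₘ i†) ≫ M.mul)
    (hb : R.mul ≫ j† = (j† ⊗ₘ j†) ≫ N.mul)
    (hV : HasDaggerBiproducts V) {T : V} {S : NormalisableFrobenius T}
    {f : T ⟶ P} (hf : IsCP S M (f ≫ i†)) (hg : IsCP S N (f ≫ j†)) : IsCP S R f := by
  obtain ⟨X, g₁, hg₁⟩ := hf
  obtain ⟨Y, g₂, hg₂⟩ := hg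
  obtain ⟨Q, x, y, hQ⟩ := hV.2 X Y
  obtain ⟨W, k, l, hW⟩ := hV.2 (X ⊗ A) (Y ⊗ B)
  obtain ⟨G, G₁, G₂⟩ : ∃ G : T ⟶ Q ⊗ P, G ≫ Q ◁ i† = g₁ ≫ x ▷ A ∧ G ≫ Q ◁ j† = g₂ ≫ y ▷ B := by
    -- The pairing of the Kraus morphisms is placed in the two diagonal blocks `X ⊗ A` and `Y ⊗ B`
    -- of `Q ⊗ P`.
    refine ⟨hW.lift g₁ g₂ ≫ hW.desc (x ⊗ₘ i) (y ⊗ₘ j), ?_, ?_⟩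
    · have e : hW.desc (x ⊗ₘ i) (y ⊗ₘ j) ≫ Q ◁ i† = k† ≫ x ▷ A := by
        apply hW.desc_ext
        · rw [reassoc_of% hW.inl_desc, reassoc_of% hW.inl_fst, ← id_tensorHom,
            tensorHom_comp_tensorHom, h.inl_fst, Category.comp_id, tensorHom_id]
        · rw [reassoc_of% hW.inr_desc, reassoc_of% hW.inr_fst_eq_zero, ← id_tensorHom,
            tensorHom_comp_tensorHom, h.inr_fst_eq_zero, tensorHom_zero, Limits.zero_comp]
      rw [Category.assoc, e, reassoc_of% hW.lift_fst]
    · have e : hW.desc (x ⊗ₘ i) (y ⊗ₘ j) ≫ Q ◁ j† = l† ≫ y ▷ B := by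
        apply hW.desc_ext
        · rw [reassoc_of% hW.inl_desc, reassoc_of% hW.inl_snd_eq_zero, ← id_tensorHom,
            tensorHom_comp_tensorHom, h.inl_snd_eq_zero, tensorHom_zero, Limits.zero_comp]
        · rw [reassoc_of% hW.inr_desc, reassoc_of% hW.inr_snd, ← id_tensorHom,
            tensorHom_comp_tensorHom, h.inr_snd, Category.comp_id, tensorHom_id]
      rw [Category.assoc, e, reassoc_of% hW.lift_snd]
  refine ⟨Q, G, ?_⟩
  apply h.whiskerRight_desc_ext T <;> apply h.whiskerLeft_hom_ext T <;>
    simp only [Category.assoc]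
  · rw [h.frobForm_diagonal ha, krausForm_diagonal hQ.inl_fst G₁, hg₁]
  · rw [h.frobForm_off_diagonal hb, krausForm_off_diagonal hQ.inl_snd_eq_zero G₁ G₂]
  · rw [h.symm.frobForm_off_diagonal ha, krausForm_off_diagonal hQ.inr_fst_eq_zero G₂ G₁]
  · rw [h.symm.frobForm_diagonal hb, krausForm_diagonal hQ.inr_snd G₂, hg₂]

end IsDaggerBiproduct

end Biproducts

/-! ### Zero objects and biproducts of CP*[V]. -/

section ZeroObjects

variable {V : Type u} [Category.{v} V] [MonoidalCategory V] [SymmetricCategory V]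
  [DaggerCategory V] [DaggerMonoidalCategory V] [DaggerCompactCategory V]

/-- The Frobenius structure of a zero object. -/
def NormalisableFrobenius.ofIsZero {Z : V} (hZ : Limits.IsZero Z) : NormalisableFrobenius Z where
  one := hZ.from_ _
  mul := hZ.from_ _
  one_mul := hZ.eq_of_tgt _ _
  mul_one := hZ.eq_of_tgt _ _
  mul_assoc := hZ.eq_of_tgt _ _
  frobenius := (isZero_tensor_right hZ Z).eq_of_tgt _ _
  normaliser := 𝟙 Z
  isIso_normaliser := inferInstance
  positive_normaliser := isPositiveMorphism_id Z
  central_left := hZ.eq_of_tgt _ _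
  central_right := hZ.eq_of_tgt _ _
  normalisable := hZ.eq_of_src _ _

lemma NormalisableFrobenius.eq_of_isZero {Z : V} (hZ : Limits.IsZero Z)
    (N N' : NormalisableFrobenius Z) : N = N' := by
  obtain ⟨⟨one, mul, _, _, _⟩, _, n, _, _, _, _, _⟩ := N
  obtain ⟨⟨one', mul', _, _, _⟩, _, n', _, _, _, _, _⟩ := N'
  obtain rfl : one = one' := hZ.eq_of_tgt _ _
  obtain rfl : mul = mul' := hZ.eq_of_tgt _ _
  obtain rfl : n = n' := hZ.eq_of_tgt _ _
  rfl

lemma isCP_of_isZero {Z B : V} (hZ : Limits.IsZero Z) (N : NormalisableFrobenius Z)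
    (M : NormalisableFrobenius B) (f : Z ⟶ B) : IsCP N M f :=
  -- Any ancilla would do, since both forms start at the zero object `B ⊗ Z`.
  ⟨𝟙_ V, hZ.to_ _, (isZero_tensor_right hZ B).eq_of_src _ _⟩

lemma CPStar.isZero_mk {Z : V} (hZ : Limits.IsZero Z) (N : NormalisableFrobenius Z) :
    Limits.IsZero (CPStar.mk Z N) where
  unique_to B := ⟨⟨⟨CPStar.ofIsCP (hZ.to_ B.X) (isCP_of_isZero hZ N B.frob _)⟩,
    fun _ => CPStar.Hom.ext (hZ.eq_of_src _ _)⟩⟩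
  unique_from B := ⟨⟨⟨CPStar.ofIsCP ((hZ.to_ B.X)†) (isCP_dagger (isCP_of_isZero hZ N B.frob _))⟩,
    fun _ => CPStar.Hom.ext (hZ.eq_of_tgt _ _)⟩⟩

/-- The zero object of `V` carries an algebra structure that is zero in CP*[V], so the factorisation
can be made there. -/
lemma CPStar.isZeroMorphism_of_hom {Z : V} (hZ : Limits.IsZero Z) {A B : CPStar V} {f : A ⟶ B}
    (hf : IsZeroMorphism f.hom) : IsZeroMorphism f := by
  have h := CPStar.isZero_mk hZ (.ofIsZero hZ)
  let := hZ.hasZeroMorphisms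
  refine ⟨_, h.from_ A, h.to_ B, h, CPStar.Hom.ext ?_⟩
  rw [hf.eq_zero]
  change 0 = (h.from_ A).hom ≫ (h.to_ B).hom
  rw [hZ.eq_of_tgt (h.from_ A).hom 0, Limits.zero_comp]

/-- The block-diagonal structure on a dagger biproduct in `V` gives a dagger biproduct in
`CPStar V`, with injections and projections that are *-homomorphisms. -/
lemma CPStar.exists_isDaggerBiproduct (hV : HasDaggerBiproducts V) (A B : CPStar V) (P : V)
    (i : A.X ⟶ P) (j : B.X ⟶ P) (h : IsDaggerBiproduct i j) :
    ∃ N : NormalisableFrobenius P,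
      (N.mul ≫ i† = (i† ⊗ₘ i†) ≫ A.frob.mul ∧ N.mul ≫ j† = (j† ⊗ₘ j†) ≫ B.frob.mul) ∧
      (N.one ≫ i† = A.frob.one ∧ N.one ≫ j† = B.frob.one) ∧
      (N.normaliser ≫ i† = i† ≫ A.frob.normaliser ∧
        N.normaliser ≫ j† = j† ≫ B.frob.normaliser) ∧
      (IsStarHomomorphism A.frob N i ∧ IsStarHomomorphism B.frob N j ∧
        IsStarHomomorphism N A.frob i† ∧ IsStarHomomorphism N B.frob j†) ∧
      ∃ (i' : A ⟶ CPStar.mk P N) (j' : B ⟶ CPStar.mk P N),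
        i'.hom = i ∧ j'.hom = j ∧ IsDaggerBiproduct i' j' := by
  obtain ⟨Z, hZ⟩ := hV.1
  let := hZ.hasZeroMorphisms
  obtain ⟨N, ⟨ma, mb⟩, ⟨ea, eb⟩, hn⟩ := h.exists_frobenius hV A.frob B.frob
  refine ⟨N, ⟨ma, mb⟩, ⟨ea, eb⟩, hn, ⟨h.isStarHomomorphism_inl ma mb ea,
    h.symm.isStarHomomorphism_inl mb ma eb, h.isStarHomomorphism_fst ma mb ea,
    h.symm.isStarHomomorphism_fst mb ma eb⟩, ofIsCP i (h.isCP_inl ma mb),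
    ofIsCP j (h.symm.isCP_inl mb ma), rfl, rfl, ?_⟩
  -- Uniqueness and the biproduct equations descend from `V`; only complete positivity of the
  -- pairing is new.
  refine IsDaggerBiproduct.of_product (fun {T} f g => ?_) (fun f g hi hj => Hom.ext ?_)
    (Hom.ext h.inl_fst) (Hom.ext h.inr_snd) (isZeroMorphism_of_hom hZ h.inl_snd)
    (isZeroMorphism_of_hom hZ h.inr_fst)
  · have h₁ := h.lift_fst f.hom g.hom
    have h₂ := h.lift_snd f.hom g.hom
    exact ⟨ofIsCP (h.lift f.hom g.hom) (h.isCP_of_components ma mb hV (by rw [h₁]; exact f.isCP)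
      (by rw [h₂]; exact g.isCP)), Hom.ext h₁, Hom.ext h₂⟩
  · exact h.hom_ext (congrArg Hom.hom hi) (congrArg Hom.hom hj)

end ZeroObjects

end

end CPStarConstruction

theorem mainTheorem4 {V : Type u} [Category.{v} V] [MonoidalCategory V] [SymmetricCategory V]
    [DaggerCategory V] [DaggerMonoidalCategory V] [DaggerCompactCategory V]
    (hV : HasDaggerBiproducts V) :
    -- the dagger category `CPStar V` is dagger compact, with structure inherited from `V`
    (∃ (_ : MonoidalCategory (CPStar V)) (_ : SymmetricCategory (CPStar V))
        (_ : DaggerMonoidalCategory (CPStar V)) (_ : DaggerCompactCategory (CPStar V))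
        (_ : (CPStar.forget V).Braided),
        (Functor.LaxMonoidal.ε (CPStar.forget V))† = Functor.OplaxMonoidal.η (CPStar.forget V) ∧
        ∀ A B : CPStar V,
          (Functor.LaxMonoidal.μ (CPStar.forget V) A B)† =
            Functor.OplaxMonoidal.δ (CPStar.forget V) A B ∧
          tensorμ A.X B.X A.X B.X ≫ (A.frob.mul ⊗ₘ B.frob.mul) ≫
              Functor.LaxMonoidal.μ (CPStar.forget V) A B =
            (Functor.LaxMonoidal.μ (CPStar.forget V) A B ⊗ₘ
              Functor.LaxMonoidal.μ (CPStar.forget V) A B) ≫ (A ⊗ B).frob.mul ∧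
          (A.frob.normaliser ⊗ₘ B.frob.normaliser) ≫
              Functor.LaxMonoidal.μ (CPStar.forget V) A B =
            Functor.LaxMonoidal.μ (CPStar.forget V) A B ≫ (A ⊗ B).frob.normaliser) ∧
    -- it has dagger biproducts
    HasDaggerBiproducts (CPStar V) ∧
    -- a zero object of `V` carries exactly one Frobenius structure, and is a zero object with it
    (∀ Z : V, Limits.IsZero Z → ∃ N : NormalisableFrobenius Z,
      (∀ N' : NormalisableFrobenius Z, N' = N) ∧ Limits.IsZero (CPStar.mk Z N)) ∧
    -- the dagger biproduct of `A` and `B` is their dagger biproduct in `V` with the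
    -- block-diagonal Frobenius structure
    (∀ (A B : CPStar V) (P : V) (i : A.X ⟶ P) (j : B.X ⟶ P), IsDaggerBiproduct i j →
      ∃ N : NormalisableFrobenius P,
        (N.mul ≫ i† = (i† ⊗ₘ i†) ≫ A.frob.mul ∧ N.mul ≫ j† = (j† ⊗ₘ j†) ≫ B.frob.mul) ∧
        (N.one ≫ i† = A.frob.one ∧ N.one ≫ j† = B.frob.one) ∧
        (N.normaliser ≫ i† = i† ≫ A.frob.normaliser ∧
          N.normaliser ≫ j† = j† ≫ B.frob.normaliser) ∧
        (IsStarHomomorphism A.frob N i ∧ IsStarHomomorphism B.frob N j ∧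
          IsStarHomomorphism N A.frob i† ∧ IsStarHomomorphism N B.frob j†) ∧
        ∃ (i' : A ⟶ CPStar.mk P N) (j' : B ⟶ CPStar.mk P N),
          i'.hom = i ∧ j'.hom = j ∧ IsDaggerBiproduct i' j') := by
  have hB := CPStar.exists_isDaggerBiproduct hV
  refine ⟨⟨CPStar.monoidalCategory, CPStar.symmetricCategory,
    CPStar.daggerMonoidalCategory, CPStar.daggerCompactCategory, CPStar.forgetBraided,
    CPStar.forget_structure⟩, ⟨?_, ?_⟩, ?_, hB⟩
  · obtain ⟨Z, hZ⟩ := hV.1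
    exact ⟨_, CPStar.isZero_mk hZ (.ofIsZero hZ)⟩
  · intro A B
    obtain ⟨P, i, j, h⟩ := hV.2 A.X B.X
    obtain ⟨N, -, -, -, -, i', j', -, -, h'⟩ := hB A B P i j h
    exact ⟨_, i', j', h'⟩
  · exact fun Z hZ => ⟨.ofIsZero hZ, fun N' => N'.eq_of_isZero hZ _, CPStar.isZero_mk hZ _⟩
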